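/- Notation: $\mathbb D$ is the open unit disc, $\mathbb T$ the unit circle, $\Gamma=\{(z+w,zw):|z|\le1,|w|\le1\}$, $b\Gamma=\{(z+w,zw):|z|=|w|=1\}$. A rational $\Gamma$-inner function is a rational map $h=(s,p)$ that is holomorphic from $\mathbb D$ to $\Gamma$ with boundary values in $b\Gamma$ at almost every point of $\mathbb T$. For $f$ differentiable and nonvanishing on $\mathbb T$ near $e^{i\theta}$, $Af(e^{i\theta})=\frac{d}{d\theta}\arg f(e^{i\theta})$. For a rational $\Gamma$-inner $h=(s,p)$ with $\deg p=m$ one writes $s=E/D$, $p=\widetilde D/D$ with $E,D$ polynomials of degree at most $m$, $D$ zero-free on $\overline{\mathbb D}$ and $\widetilde D(\lambda)=\lambda^m\overline{D(1/\bar\lambda)}$; the royal polynomial of $h$ is $R=4D\widetilde D-E^2$, and $h$ is of type $(n,k)$ (written $h\in\mathcal R^{n,k}$) if $R\neq0$ and the multiplicities of the zeros of $R$ in $\overline{\mathbb D}$, respectively in $\mathbb T$, add up to $n$, respectively $k$, where the multiplicity of a zero of order $\ell$ is $\ell$ if it lies in $\mathbb D$ and $\ell/2$ if it lies in $\mathbb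 T$. For $\omega\in\mathbb T$ let $\Phi_\omega(s,p)=\dfrac{2\omega p-s}{2-\omega s}$. Let $n\ge1$, $0\le k\le n$, and let $(\sigma,\eta,\rho)$ be Blaschke interpolation data: $\sigma_1,\dots,\sigma_n$ are distinct, $\sigma_j,\eta_j\in\mathbb T$ and $\rho_j>0$ for $j\le k$, and $\sigma_j,\eta_j\in\mathbb D$ for $k<j\le n$. The Blaschke interpolation problem asks for a rational inner function $\varphi$ of degree $n$ with $\varphi(\sigma_j)=\eta_j$ for $j=1,\dots,n$ and $A\varphi(\sigma_j)=\rho_j$ for $j=1,\dots,k$. Suppose that this problem is solvable and that its solutions have the normalized parametrization $\varphi=\dfrac{a\zeta+b}{c\zeta+d}$; that is, $a,b,c,d$ are polynomials of degree at most $n$; for all but at most $k$ values of $\zeta\in\mathbb T$ the function $\frac{a\zeta+b}{c\zeta+d}$ is a solution; for some $\tau\in\mathbb T\setminus\{\sigma_1,\dots,\sigma_k\}$, $a(\tau)=d(\tau)=1$ and $b(\tau)=c(\tau)=0$; and every solution is of this form for some $\zeta\in\mathbb T$. Suppose that $s_0,p_0\in\mathbb C$ satisfy $$|p_0|=1,\qquad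 s_0=\overline{s_0}\,p_0,\qquad |s_0|<2,\qquad s_0a-2b+2p_0c-s_0d=0 .$$ Let $$s=2\,\frac{2p_0c-s_0d}{s_0c-2d},\qquad p=\frac{-2p_0a+s_0b}{s_0c-2d}.$$ Then $h=(s,p)$ is a rational $\Gamma$-inner function such that (i) $h\in\mathcal R^{n,k}$; (ii) $h(\sigma_j)=(-2\eta_j,\eta_j^2)$ for $j=1,\dots,n$; (iii) $Ap(\sigma_j)=2\rho_j$ for $j=1,\dots,k$; (iv) for all but finitely many $\omega\in\mathbb T$, the function $\Phi_\omega\circ h$ is a solution of the Blaschke interpolation problem with data $(\sigma,\eta,\rho)$. -/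

import Mathlib

open Polynomial Topology Filter

noncomputable section

namespace RoyalInterp

/-- The closed symmetrized bidisc `Γ`. -/
def Gam : Set (ℂ × ℂ) := {x | ∃ z w : ℂ, ‖z‖ ≤ 1 ∧ ‖w‖ ≤ 1 ∧ x = (z + w, z * w)}

/-- The distinguished boundary `bΓ`: the symmetrization of the 2-torus. -/
def bGam : Set (ℂ × ℂ) := {x | ∃ z w : ℂ, ‖z‖ = 1 ∧ ‖w‖ = 1 ∧ x = (z + w, z * w)}

/-- `f` has radial limit `l` at the point `e^{iθ}` of the unit circle. -/
def HasRadialLimit {E : Type*} [TopologicalSpace E] (f : ℂ → E) (θ : ℝ) (l : E) : Prop :=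
  Tendsto (fun r : ℝ => f ((r : ℂ) * Complex.exp ((θ : ℂ) * Complex.I))) (𝓝[<] (1 : ℝ)) (𝓝 l)

/-- Inner functions on the unit disc: holomorphic, bounded by one, with unimodular boundary
values at almost every point of the unit circle. -/
def IsInner (f : ℂ → ℂ) : Prop :=
  DifferentiableOn ℂ f (Metric.ball 0 1) ∧
  (∀ z ∈ Metric.ball (0 : ℂ) 1, ‖f z‖ ≤ 1) ∧
  ∀ᵐ θ : ℝ, ∃ l : ℂ, ‖l‖ = 1 ∧ HasRadialLimit f θ l

/-- `Γ`-inner functions: holomorphic maps from the unit disc to `Γ` whose boundary values lie in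
`bΓ` at almost every point of the unit circle. -/
def IsGammaInner (h : ℂ → ℂ × ℂ) : Prop :=
  DifferentiableOn ℂ h (Metric.ball 0 1) ∧
  (∀ z ∈ Metric.ball (0 : ℂ) 1, h z ∈ Gam) ∧
  ∀ᵐ θ : ℝ, ∃ l : ℂ × ℂ, l ∈ bGam ∧ HasRadialLimit h θ l

/-- The value of a rational function at a complex number (only used away from the poles). -/
def val (f : RatFunc ℂ) (z : ℂ) : ℂ := f.eval (RingHom.id ℂ) z

/-- The degree of a rational function: the larger of the degrees of numerator and denominator in
lowest terms. For a finite Blaschke product it is the number of factors. -/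
def ratDegree (f : RatFunc ℂ) : ℕ := max f.num.natDegree f.denom.natDegree

/-- `(s, p)` is a rational `Γ`-inner function. Both coordinates are then free of poles in the
closed disc, since `Γ` is bounded. -/
def IsRationalGammaInner (s p : RatFunc ℂ) : Prop :=
  IsGammaInner (fun z => (val s z, val p z))

/-- The phasar derivative `A f(z)` of `f` at the point `z` of the unit circle exists and equals
`A`: if `z = e^{iθ}` and `f(e^{it}) = R(t) e^{i g(t)}` near `θ`, with `R > 0` and `g` real and
differentiable at `θ`, then `A f(z) = g'(θ)`. -/
def HasPhasarDerivAt (f : ℂ → ℂ) (z : ℂ) (A : ℝ) : Prop :=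
  ∃ (θ : ℝ) (R g : ℝ → ℝ), z = Complex.exp ((θ : ℂ) * Complex.I) ∧
    (∀ᶠ t in 𝓝 θ, 0 < R t ∧
      f (Complex.exp ((t : ℂ) * Complex.I)) = (R t : ℂ) * Complex.exp ((g t : ℂ) * Complex.I)) ∧
    HasDerivAt g A θ

/-- Blaschke interpolation data `(σ, η, ρ)` with `n` nodes, of which the first `k` lie on the unit
circle and the others in the open unit disc. -/
structure BlaschkeData (n k : ℕ) where
  one_le : 1 ≤ n
  le : k ≤ n
  σ : Fin n → ℂ
  η : Fin n → ℂ
  ρ : Fin k → ℝ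
  σ_injective : Function.Injective σ
  σ_circle : ∀ j : Fin n, (j : ℕ) < k → ‖σ j‖ = 1
  σ_disc : ∀ j : Fin n, k ≤ (j : ℕ) → ‖σ j‖ < 1
  η_circle : ∀ j : Fin n, (j : ℕ) < k → ‖η j‖ = 1
  η_disc : ∀ j : Fin n, k ≤ (j : ℕ) → ‖η j‖ < 1
  ρ_pos : ∀ j : Fin k, 0 < ρ j

/-- `φ` solves the Blaschke interpolation problem: `φ` is a rational inner function of degree
(exactly) `n` with `φ(σ_j) = η_j` for all `j` and `Aφ(σ_j) = ρ_j` for the nodes on the circle. -/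
def BlaschkeData.IsSolution {n k : ℕ} (B : BlaschkeData n k) (φ : RatFunc ℂ) : Prop :=
  IsInner (val φ) ∧ ratDegree φ = n ∧
  (∀ j : Fin n, val φ (B.σ j) = B.η j) ∧
  ∀ j : Fin k, HasPhasarDerivAt (val φ) (B.σ (Fin.castLE B.le j)) (B.ρ j)

/-- The rational function `(aζ + b) / (cζ + d)`. -/
def linFrac (a b c d : ℂ[X]) (ζ : ℂ) : RatFunc ℂ :=
  algebraMap ℂ[X] (RatFunc ℂ) (a * C ζ + b) / algebraMap ℂ[X] (RatFunc ℂ) (c * C ζ + d)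

/-- `φ = (aζ + b) / (cζ + d)` is a normalized linear fractional parametrization of the solutions
of the Blaschke interpolation problem with data `B`. -/
structure BlaschkeData.IsNormalizedParametrization {n k : ℕ} (B : BlaschkeData n k)
    (a b c d : ℂ[X]) : Prop where
  degree_le : a.natDegree ≤ n ∧ b.natDegree ≤ n ∧ c.natDegree ≤ n ∧ d.natDegree ≤ n
  isSolution : ∃ F : Finset ℂ, F.card ≤ k ∧
    ∀ ζ : ℂ, ‖ζ‖ = 1 → ζ ∉ F → B.IsSolution (linFrac a b c d ζ)
  normalized : ∃ τ : ℂ, ‖τ‖ = 1 ∧ (∀ j : Fin n, (j : ℕ) < k → τ ≠ B.σ j) ∧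
    a.eval τ = 1 ∧ b.eval τ = 0 ∧ c.eval τ = 0 ∧ d.eval τ = 1
  exhaustive : ∀ φ : RatFunc ℂ, B.IsSolution φ → ∃ ζ : ℂ, ‖ζ‖ = 1 ∧ φ = linFrac a b c d ζ

/-- The reflected polynomial `z ↦ z ^ m * conj (D (1 / conj z))`, for `D` of degree at most `m`. -/
def reflectConj (m : ℕ) (D : ℂ[X]) : ℂ[X] := (D.reflect m).map (starRingEnd ℂ)

/-- `R` is a royal polynomial of the rational `Γ`-inner function `(s, p)`: with `m` the degree
of `p` (which is the degree of `(s, p)`), write `s = E / D` and `p = D~ / D`, where `E` and `D` are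
polynomials of degree at most `m`, `D` has no zero in the closed disc and
`D~ = reflectConj m D`; then `R = D ^ 2 (4 p - s ^ 2) = 4 D D~ - E ^ 2`.
For given `(s, p)`, the pair `(E, D)` is unique up to a real factor. -/
def IsRoyalPolynomial (s p : RatFunc ℂ) (R : ℂ[X]) : Prop :=
  ∃ E D : ℂ[X], E.natDegree ≤ ratDegree p ∧ D.natDegree ≤ ratDegree p ∧
    (∀ z : ℂ, ‖z‖ ≤ 1 → D.eval z ≠ 0) ∧
    s = algebraMap ℂ[X] (RatFunc ℂ) E / algebraMap ℂ[X] (RatFunc ℂ) D ∧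
    p = algebraMap ℂ[X] (RatFunc ℂ) (reflectConj (ratDegree p) D) /
      algebraMap ℂ[X] (RatFunc ℂ) D ∧
    R = 4 * D * reflectConj (ratDegree p) D - E ^ 2

open scoped Classical in
/-- The multiplicity of a royal node: the order of the zero of the royal polynomial in the open
disc, half of that order on the circle. -/
def royalMultiplicity (R : ℂ[X]) (z : ℂ) : ℚ :=
  if ‖z‖ < 1 then (R.rootMultiplicity z : ℚ) else (R.rootMultiplicity z : ℚ) / 2

open scoped Classical in
/-- `(s, p)` belongs to `𝓡^{n,k}`: it is a rational `Γ`-inner function, its royal polynomial is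
not zero, the multiplicities of its royal nodes in the closed disc add up to `n`, and those of its
royal nodes on the circle add up to `k`. -/
def HasType (n k : ℕ) (s p : RatFunc ℂ) : Prop :=
  IsRationalGammaInner s p ∧ ∃ R : ℂ[X], IsRoyalPolynomial s p R ∧ R ≠ 0 ∧
    ∑ z ∈ R.roots.toFinset with ‖z‖ ≤ 1, royalMultiplicity R z = n ∧
    ∑ z ∈ R.roots.toFinset with ‖z‖ = 1, royalMultiplicity R z = k

/-- `Φ_ω(s, p) = (2ωp - s) / (2 - ωs)`, for numbers or for rational functions `s`, `p`; in the
second case it is the rational function `Φ_ω ∘ (s, p)`. -/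
def Phi {K : Type*} [Field K] [Algebra ℂ K] (ω : ℂ) (s p : K) : K :=
  (2 * algebraMap ℂ K ω * p - s) / (2 - algebraMap ℂ K ω * s)

end RoyalInterp

end

noncomputable section

namespace RoyalInterp

open scoped ComplexConjugate

/-! Everything rests on one identity. For unimodular `ω` put `ζ = Φ_ω(s₀, p₀)`, which is unimodular
because `s₀ = conj s₀ * p₀` and `|p₀| = 1`. The linear relation between `a, b, c, d` makes `Φ_ω ∘ h`
equal to `(aζ + b)/(cζ + d)` (`Phi_eq_linFrac`). As `4p₀ ≠ s₀²`, the map `ω ↦ ζ` is injective, so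
only finitely many `ω` meet an exceptional `ζ`; this is (iv). The bounds on `aζ + b` and `cζ + d`
extend by continuity to all unimodular `ζ`, hence `|Φ_ω ∘ h| ≤ 1` for every `ω`. With `|s| ≤ 2` this
puts `h` in `Γ`, and equality on the circle forces `|p| = 1` there, so `h` lies in `bΓ`.

The conditions on a solution become affine in `ζ` once denominators are cleared and the
normalization at `τ` is used, so two values of `ζ` separate the coefficients (`exists_isResolvent`):
`a = η c` and `b = η d` at the nodes, similar identities for derivatives at circle nodes, and the
reflections `c~ = τ^n b`, `d~ = τ^n a`. An open mapping argument gives `|c| ≤ |d|` on the closed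
disc, so `s₀c - 2d` has no zero there. Inserting the node identities in the linear relation yields
(ii) and (iii).

For (i), the royal polynomial is a nonzero constant times `ad - bc`. This has degree at most `2n`,
is self-reflexive, and vanishes at every node, doubly at those on the circle. That accounts for all
its zeros. -/

/-- The rational function `N / Q`. -/
abbrev quot (N Q : ℂ[X]) : RatFunc ℂ :=
  algebraMap ℂ[X] (RatFunc ℂ) N / algebraMap ℂ[X] (RatFunc ℂ) Q

/-! ### Quotients of polynomials and lowest terms. -/

theorem eval_denom_quot_ne_zero {N Q : ℂ[X]} {z : ℂ} (h : Q.eval z ≠ 0) :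
    (quot N Q).denom.eval z ≠ 0 := by
  obtain ⟨u, hu⟩ := RatFunc.denom_div_dvd N Q
  intro h0
  apply h
  rw [hu, eval_mul, h0, zero_mul]

theorem num_mul_eq_mul_denom (N : ℂ[X]) {Q : ℂ[X]} (hQ : Q ≠ 0) :
    (quot N Q).num * Q = N * (quot N Q).denom :=
  (RatFunc.num_mul_eq_mul_denom_iff hQ).2 rfl

theorem val_eq (f : RatFunc ℂ) (z : ℂ) : val f z = f.num.eval z / f.denom.eval z := by
  simp only [val, RatFunc.eval, eval₂_id]

theorem val_quot {N Q : ℂ[X]} {z : ℂ} (h : Q.eval z ≠ 0) :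
    val (quot N Q) z = N.eval z / Q.eval z := by
  have hQ : Q ≠ 0 := by rintro rfl; simp at h
  have := congrArg (eval z) (num_mul_eq_mul_denom N hQ)
  rw [eval_mul, eval_mul] at this
  rw [val_eq, div_eq_div_iff (eval_denom_quot_ne_zero h) h, this]

theorem hasDerivAt_val_quot (N : ℂ[X]) {Q : ℂ[X]} {z : ℂ} (h : Q.eval z ≠ 0) :
    HasDerivAt (val (quot N Q))
      ((N.derivative.eval z * Q.eval z - N.eval z * Q.derivative.eval z) / Q.eval z ^ 2) z := by
  refine ((N.hasDerivAt z).div (Q.hasDerivAt z) h).congr_of_eventuallyEq ?_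
  filter_upwards [Q.continuous.continuousAt.eventually_ne h] with w hw
  exact val_quot hw

/-- If `N / Q` has degree `n` although `N` and `Q` have degree at most `n`, then it is in lowest
terms. -/
theorem lowest_terms_of_ratDegree {n : ℕ} (hn : 1 ≤ n) {N Q : ℂ[X]} (hN : N.natDegree ≤ n)
    (hQ : Q.natDegree ≤ n) (h : ratDegree (quot N Q) = n) :
    ∃ u : ℂ, u ≠ 0 ∧ N = C u * (quot N Q).num ∧ Q = C u * (quot N Q).denom := by
  -- With `Q = 0` the quotient is `0` by convention, of degree `0 < n`.
  have hQ0 : Q ≠ 0 := by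
    rintro rfl
    simp [ratDegree, quot] at h
    omega
  obtain ⟨u, hu⟩ := RatFunc.denom_div_dvd N Q
  change Q = (quot N Q).denom * u at hu
  have hd := RatFunc.denom_ne_zero (quot N Q)
  have hu0 : u ≠ 0 := by
    rintro rfl
    exact hQ0 (by rw [hu, mul_zero])
  have hNu : N = (quot N Q).num * u := by
    have := num_mul_eq_mul_denom N hQ0
    apply mul_right_cancel₀ hd
    rw [← this]
    nth_rewrite 2 [hu]
    ring
  have hdeg : u.natDegree = 0 := by
    rcases max_choice (quot N Q).num.natDegree (quot N Q).denom.natDegree with h' | h'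
    · have h1 : (quot N Q).num.natDegree = n := by rw [← h', ← h]; rfl
      have h2 : (quot N Q).num ≠ 0 := by
        intro h0
        rw [h0] at h1
        simp at h1
        omega
      have := natDegree_mul h2 hu0
      rw [← hNu] at this
      omega
    · have h1 : (quot N Q).denom.natDegree = n := by rw [← h', ← h]; rfl
      have := natDegree_mul hd hu0
      rw [← hu] at this
      omega
  obtain ⟨v, rfl⟩ := natDegree_eq_zero.1 hdeg
  refine ⟨v, ?_, by rw [mul_comm]; exact hNu, by rw [mul_comm]; exact hu⟩
  rintro rfl
  simp at hu0

theorem ratDegree_quot_of_isCoprime {n : ℕ} {N Q : ℂ[X]} (h : IsCoprime N Q)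
    (hN : N.natDegree = n) (hQ : Q.natDegree ≤ n) (hQ0 : Q ≠ 0) : ratDegree (quot N Q) = n := by
  have key := num_mul_eq_mul_denom N hQ0
  have hc := RatFunc.isCoprime_num_denom (quot N Q)
  have h1 : N ∣ (quot N Q).num := h.dvd_of_dvd_mul_right ⟨_, key⟩
  have h2 : (quot N Q).num ∣ N := hc.dvd_of_dvd_mul_right ⟨_, key.symm⟩
  have h3 : (quot N Q).denom ∣ Q := RatFunc.denom_div_dvd N Q
  have h4 : (quot N Q).num.natDegree = N.natDegree :=
    natDegree_eq_of_degree_eq (degree_eq_degree_of_associated (associated_of_dvd_dvd h2 h1))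
  have h5 := natDegree_le_of_dvd h3 hQ0
  unfold ratDegree
  omega

/-! ### Rational inner functions on the closed disc. -/

/-- At a pole `val f` has the default value `0`, so `|f| ≤ 1` says nothing there. Poles are finite
in number, and the inequality between numerator and denominator is closed, so it passes to the
closed disc. Coprimality then excludes poles. -/
theorem norm_eval_num_le_norm_eval_denom {f : RatFunc ℂ} (hf : IsInner (val f)) {z : ℂ}
    (hz : ‖z‖ ≤ 1) : ‖f.num.eval z‖ ≤ ‖f.denom.eval z‖ := by
  let S : Set ℂ := {w | f.denom.eval w = 0}
  have hS : S.Finite := by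
    refine (f.denom.roots.toFinset.finite_toSet).subset fun w hw => ?_
    simpa [RatFunc.denom_ne_zero, S] using hw
  have hd : Dense Sᶜ := hS.countable.dense_compl ℂ
  have hcl : z ∈ closure (Metric.ball (0 : ℂ) 1 ∩ Sᶜ) := by
    have h1 : z ∈ closure (Metric.ball (0 : ℂ) 1) := by
      rw [closure_ball _ one_ne_zero]
      simpa using hz
    exact closure_minimal (hd.open_subset_closure_inter Metric.isOpen_ball) isClosed_closure h1
  have hclosed : IsClosed {w : ℂ | ‖f.num.eval w‖ ≤ ‖f.denom.eval w‖} :=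
    isClosed_le f.num.continuous.norm f.denom.continuous.norm
  refine closure_minimal ?_ hclosed hcl
  rintro w ⟨hw, hwS⟩
  have h1 := hf.2.1 w hw
  have h2 : 0 < ‖f.denom.eval w‖ := norm_pos_iff.2 hwS
  rw [val_eq, norm_div, div_le_one h2] at h1
  exact h1

theorem eval_denom_ne_zero_of_isInner {f : RatFunc ℂ} (hf : IsInner (val f)) {z : ℂ}
    (hz : ‖z‖ ≤ 1) : f.denom.eval z ≠ 0 := by
  intro h
  have h1 := norm_eval_num_le_norm_eval_denom hf hz
  rw [h, norm_zero] at h1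
  have h2 := norm_le_zero_iff.1 h1
  obtain ⟨x, y, hxy⟩ := RatFunc.isCoprime_num_denom f
  have := congrArg (eval z) hxy
  simp [h, h2] at this

theorem hasRadialLimit_of_continuousAt {E : Type*} [TopologicalSpace E] {f : ℂ → E} {θ : ℝ}
    (h : ContinuousAt f (Complex.exp ((θ : ℂ) * Complex.I))) :
    HasRadialLimit f θ (f (Complex.exp ((θ : ℂ) * Complex.I))) := by
  unfold HasRadialLimit
  have h1 : Tendsto (fun r : ℝ => (r : ℂ) * Complex.exp ((θ : ℂ) * Complex.I)) (𝓝[<] (1 : ℝ))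
      (𝓝 (Complex.exp ((θ : ℂ) * Complex.I))) := by
    have : Continuous (fun r : ℝ => (r : ℂ) * Complex.exp ((θ : ℂ) * Complex.I)) := by fun_prop
    have h2 := this.tendsto 1
    simp only [Complex.ofReal_one, one_mul] at h2
    exact h2.mono_left nhdsWithin_le_nhds
  exact h.tendsto.comp h1

theorem exists_eq_exp_of_norm_eq_one {z : ℂ} (hz : ‖z‖ = 1) :
    Complex.exp ((z.arg : ℂ) * Complex.I) = z := by
  have := Complex.norm_mul_exp_arg_mul_I z
  rwa [hz, Complex.ofReal_one, one_mul] at this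

/-- Without poles, radial limits are values; two continuous functions of `θ` that agree almost
everywhere agree everywhere. -/
theorem norm_eval_num_eq_norm_eval_denom {f : RatFunc ℂ} (hf : IsInner (val f)) {z : ℂ}
    (hz : ‖z‖ = 1) : ‖f.num.eval z‖ = ‖f.denom.eval z‖ := by
  let F : ℝ → ℝ := fun θ => ‖f.num.eval (Complex.exp ((θ : ℂ) * Complex.I))‖
  let G : ℝ → ℝ := fun θ => ‖f.denom.eval (Complex.exp ((θ : ℂ) * Complex.I))‖
  have hF : Continuous F := by
    have : Continuous fun θ : ℝ => Complex.exp ((θ : ℂ) * Complex.I) := by fun_prop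
    exact (f.num.continuous.comp this).norm
  have hG : Continuous G := by
    have : Continuous fun θ : ℝ => Complex.exp ((θ : ℂ) * Complex.I) := by fun_prop
    exact (f.denom.continuous.comp this).norm
  have hFG : F =ᵐ[MeasureTheory.volume] G := by
    filter_upwards [hf.2.2] with θ ⟨l, hl, hlim⟩
    have hne := eval_denom_ne_zero_of_isInner hf
      (z := Complex.exp ((θ : ℂ) * Complex.I)) (by simp [Complex.norm_exp_ofReal_mul_I])
    have hcont : ContinuousAt (val f) (Complex.exp ((θ : ℂ) * Complex.I)) := by
      have : val f = fun z => f.num.eval z / f.denom.eval z := funext (val_eq f)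
      rw [this]
      exact f.num.continuous.continuousAt.div f.denom.continuous.continuousAt hne
    have := tendsto_nhds_unique hlim (hasRadialLimit_of_continuousAt hcont)
    rw [this, val_eq, norm_div, div_eq_one_iff_eq (norm_ne_zero_iff.2 hne)] at hl
    exact hl
  have := congrFun ((hF.ae_eq_iff_eq _ hG).1 hFG) z.arg
  simpa only [F, G, exists_eq_exp_of_norm_eq_one hz] using this

/-! ### The phasar derivative as the logarithmic derivative `z f' / f`. -/

theorem hasDerivAt_comp_exp {f : ℂ → ℂ} {f' : ℂ} {θ : ℝ}
    (hf : HasDerivAt f f' (Complex.exp ((θ : ℂ) * Complex.I))) :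
    HasDerivAt (fun t : ℝ => f (Complex.exp ((t : ℂ) * Complex.I)))
      (f' * (Complex.exp ((θ : ℂ) * Complex.I) * Complex.I)) θ := by
  have h1 : HasDerivAt (fun t : ℂ => Complex.exp (t * Complex.I))
      (Complex.exp ((θ : ℂ) * Complex.I) * Complex.I) (θ : ℂ) := by
    simpa using ((hasDerivAt_id (θ : ℂ)).mul_const Complex.I).cexp
  exact (HasDerivAt.comp (θ : ℂ) hf h1).comp_ofReal

theorem HasPhasarDerivAt.mul_deriv_eq {f : ℂ → ℂ} {z f' : ℂ} {A : ℝ}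
    (h : HasPhasarDerivAt f z A) (hf : HasDerivAt f f' z) (h1 : ∀ w : ℂ, ‖w‖ = 1 → ‖f w‖ = 1) :
    z * f' = A * f z := by
  obtain ⟨θ, R, g, rfl, hev, hg⟩ := h
  have hfe : (fun t : ℝ => f (Complex.exp ((t : ℂ) * Complex.I))) =ᶠ[𝓝 θ]
      fun t => Complex.exp ((g t : ℂ) * Complex.I) := by
    filter_upwards [hev] with t ⟨hR, ht⟩
    have h2 := h1 (Complex.exp ((t : ℂ) * Complex.I)) (Complex.norm_exp_ofReal_mul_I t)
    rw [ht, norm_mul, Complex.norm_exp_ofReal_mul_I, mul_one, Complex.norm_real,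
      Real.norm_of_nonneg hR.le] at h2
    rw [ht, h2, Complex.ofReal_one, one_mul]
  have hd1 := hasDerivAt_comp_exp hf
  have hd2 : HasDerivAt (fun t : ℝ => Complex.exp ((g t : ℂ) * Complex.I))
      (Complex.exp ((g θ : ℂ) * Complex.I) * (A * Complex.I)) θ :=
    ((hg.ofReal_comp).mul_const Complex.I).cexp
  have := hd1.unique (hd2.congr_of_eventuallyEq hfe)
  have hθ := hfe.self_of_nhds
  simp only at hθ
  rw [hθ]
  apply mul_right_cancel₀ Complex.I_ne_zero
  linear_combination this

theorem hasPhasarDerivAt_of_mul_deriv_eq {f : ℂ → ℂ} {z f' : ℂ} {A : ℝ} (hz : ‖z‖ = 1)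
    (hf : HasDerivAt f f' z) (h1 : ∀ w : ℂ, ‖w‖ = 1 → ‖f w‖ = 1) (h : z * f' = A * f z) :
    HasPhasarDerivAt f z A := by
  have hfz : f z ≠ 0 := norm_ne_zero_iff.1 (by rw [h1 z hz]; exact one_ne_zero)
  have he := exists_eq_exp_of_norm_eq_one hz
  have hd := hasDerivAt_comp_exp (θ := z.arg) (he.symm ▸ hf)
  rw [he] at hd
  have hd2 := hd.div_const (f z)
  -- Dividing by `f z` moves the value to `1`, where the principal logarithm is differentiable; its
  -- imaginary part plus `arg (f z)` is the required phase.
  have hone : f (Complex.exp ((z.arg : ℂ) * Complex.I)) / f z = 1 := by rw [he, div_self hfz]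
  have hd3 := hd2.clog_real (by rw [hone]; exact Complex.one_mem_slitPlane)
  have hd4 := (Complex.imCLM.hasFDerivAt.comp_hasDerivAt z.arg hd3).add_const (f z).arg
  refine ⟨z.arg, fun _ => 1,
    fun t => (Complex.log (f (Complex.exp ((t : ℂ) * Complex.I)) / f z)).im + (f z).arg,
    he.symm, Eventually.of_forall fun t => ⟨one_pos, ?_⟩, ?_⟩
  · beta_reduce
    have hn := h1 (Complex.exp ((t : ℂ) * Complex.I)) (Complex.norm_exp_ofReal_mul_I t)
    have hq : ‖f (Complex.exp ((t : ℂ) * Complex.I)) / f z‖ = 1 := by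
      rw [norm_div, hn, h1 z hz, div_one]
    rw [Complex.log_im, Complex.ofReal_add, add_mul, Complex.exp_add,
      exists_eq_exp_of_norm_eq_one hq, exists_eq_exp_of_norm_eq_one (h1 z hz),
      div_mul_cancel₀ _ hfz, Complex.ofReal_one, one_mul]
  · rw [hone, div_one] at hd4
    have : f' * (z * Complex.I) / f z = A * Complex.I := by
      rw [div_eq_iff hfz]
      linear_combination Complex.I * h
    rw [this] at hd4
    simpa using hd4

/-! ### Reflection of polynomials in the circle. -/

theorem natDegree_reflectConj_le {m : ℕ} {D : ℂ[X]} (h : D.natDegree ≤ m) :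
    (reflectConj m D).natDegree ≤ m := by
  unfold reflectConj
  refine (natDegree_map_le).trans ?_
  exact (natDegree_reflect_le).trans (max_le le_rfl h)

theorem eval_reflectConj {m : ℕ} {D : ℂ[X]} (h : D.natDegree ≤ m) {z : ℂ} (hz : z ≠ 0) :
    (reflectConj m D).eval z = z ^ m * conj (D.eval (conj z)⁻¹) := by
  have hz' : (conj z)⁻¹ ≠ 0 := inv_ne_zero ((_root_.map_ne_zero _).2 hz)
  let : Invertible (conj z)⁻¹ := invertibleOfNonzero hz'
  have h1 := eval₂_reflect_mul_pow (RingHom.id ℂ) (conj z)⁻¹ m D h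
  rw [invOf_eq_inv, inv_inv, eval₂_id, eval₂_id] at h1
  have h2 : (reflectConj m D).eval z = conj ((D.reflect m).eval (conj z)) := by
    unfold reflectConj
    rw [eval_map]
    nth_rewrite 1 [← Complex.conj_conj z]
    rw [eval₂_at_apply]
  rw [h2, ← h1]
  simp only [map_mul, map_pow, map_inv₀, Complex.conj_conj]
  rw [mul_left_comm, ← mul_pow, mul_inv_cancel₀ hz, one_pow, mul_one]

theorem eval_reflectConj_of_norm_eq_one {m : ℕ} {D : ℂ[X]} (h : D.natDegree ≤ m) {z : ℂ}
    (hz : ‖z‖ = 1) : (reflectConj m D).eval z = z ^ m * conj (D.eval z) := by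
  have hz0 : z ≠ 0 := norm_ne_zero_iff.1 (by rw [hz]; exact one_ne_zero)
  rw [eval_reflectConj h hz0, ← Complex.inv_eq_conj hz, inv_inv]

theorem reflectConj_reflectConj (m : ℕ) (D : ℂ[X]) : reflectConj m (reflectConj m D) = D := by
  unfold reflectConj
  rw [reflect_map, reflect_reflect, Polynomial.map_map]
  have : (starRingEnd ℂ).comp (starRingEnd ℂ) = RingHom.id ℂ := by
    ext z; simp
  rw [this, Polynomial.map_id]

theorem reflectConj_add (m : ℕ) (f g : ℂ[X]) :
    reflectConj m (f + g) = reflectConj m f + reflectConj m g := by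
  simp [reflectConj, reflect_add]

theorem reflectConj_sub (m : ℕ) (f g : ℂ[X]) :
    reflectConj m (f - g) = reflectConj m f - reflectConj m g := by
  simp [reflectConj, reflect_sub]

theorem reflectConj_C_mul (m : ℕ) (f : ℂ[X]) (r : ℂ) :
    reflectConj m (C r * f) = C (conj r) * reflectConj m f := by
  simp [reflectConj, reflect_C_mul]

theorem reflectConj_mul {l m : ℕ} {f g : ℂ[X]} (hf : f.natDegree ≤ l) (hg : g.natDegree ≤ m) :
    reflectConj (l + m) (f * g) = reflectConj l f * reflectConj m g := by
  simp [reflectConj, reflect_mul f g hf hg]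

theorem coeff_reflectConj (m : ℕ) (D : ℂ[X]) :
    (reflectConj m D).coeff m = conj (D.eval 0) := by
  rw [reflectConj, coeff_map, coeff_reflect, revAt_le le_rfl, Nat.sub_self,
    coeff_zero_eq_eval_zero]

theorem infinite_circle : {z : ℂ | ‖z‖ = 1}.Infinite := by
  have : {z : ℂ | ‖z‖ = 1} = Metric.sphere 0 1 := by ext; simp
  rw [this]
  refine IsPreconnected.infinite_of_nontrivial ?_ ?_
  · exact isPreconnected_sphere (by rw [Complex.rank_real_complex]; norm_num) _ _
  · exact ⟨1, by simp, -1, by simp, by norm_num [Complex.ext_iff]⟩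

theorem eq_of_eval_eq_on_circle {f g : ℂ[X]} (h : ∀ z : ℂ, ‖z‖ = 1 → f.eval z = g.eval z) :
    f = g :=
  eq_of_infinite_eval_eq f g (infinite_circle.mono h)

/-- An inner function `N / Q` in lowest terms, of degree `n`, is a unimodular multiple of
`Q~ / Q`. -/
theorem exists_reflectConj_eq_C_mul {n : ℕ} {N Q : ℂ[X]} (hN : N.natDegree ≤ n)
    (hQ : Q.natDegree ≤ n) (hmax : max N.natDegree Q.natDegree = n) (hc : IsCoprime N Q)
    (hQ0 : Q.eval 0 ≠ 0) (h : ∀ z : ℂ, ‖z‖ = 1 → ‖N.eval z‖ = ‖Q.eval z‖) :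
    ∃ κ : ℂ, reflectConj n Q = C κ * N := by
  have hQne : Q ≠ 0 := by rintro rfl; simp at hQ0
  have hNQ : N * reflectConj n N = Q * reflectConj n Q := by
    refine eq_of_eval_eq_on_circle fun z hz => ?_
    rw [eval_mul, eval_mul, eval_reflectConj_of_norm_eq_one hN hz,
      eval_reflectConj_of_norm_eq_one hQ hz, mul_left_comm, Complex.mul_conj', h z hz,
      mul_left_comm (eval z Q), Complex.mul_conj']
  have hQ'0 : (reflectConj n Q).coeff n ≠ 0 := by
    rw [coeff_reflectConj]
    exact (_root_.map_ne_zero _).2 hQ0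
  have hQ'ne : reflectConj n Q ≠ 0 := by
    intro h0
    rw [h0] at hQ'0
    simp at hQ'0
  obtain ⟨t, ht⟩ : N ∣ reflectConj n Q := hc.dvd_of_dvd_mul_left ⟨_, hNQ.symm⟩
  have hNne : N ≠ 0 := by
    rintro rfl
    exact hQ'ne (by rw [ht, zero_mul])
  have htne : t ≠ 0 := by
    rintro rfl
    exact hQ'ne (by rw [ht, mul_zero])
  -- The cofactor `t` divides both reflections, so `deg N + deg t` and `deg Q + deg t` are at most
  -- `n`; one of `N`, `Q` has degree `n`, hence `t` is constant.
  have hN't : reflectConj n N = Q * t := by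
    apply mul_left_cancel₀ hNne
    rw [hNQ, ht]
    ring
  have hd1 := natDegree_mul hNne htne
  rw [← ht] at hd1
  have hd2 := natDegree_mul hQne htne
  rw [← hN't] at hd2
  have hd3 := natDegree_reflectConj_le hQ
  have hd4 := natDegree_reflectConj_le hN
  have ht0 : t.natDegree = 0 := by omega
  obtain ⟨κ, rfl⟩ := natDegree_eq_zero.1 ht0
  exact ⟨κ, by rw [ht, mul_comm]⟩

/-! ### Membership of `Γ` and `bΓ`. -/

theorem norm_le_one_of_symmetrization {z w : ℂ} (hs : ‖z + w‖ ≤ 2)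
    (hv : ‖z + w - z * w * conj (z + w)‖ ≤ 1 - ‖z * w‖ ^ 2) : ‖z‖ ≤ 1 := by
  by_contra! hx
  have hveq : z + w - z * w * conj (z + w) =
      z * ((1 - ‖w‖ ^ 2 : ℝ) : ℂ) - w * ((‖z‖ ^ 2 - 1 : ℝ) : ℂ) := by
    push_cast
    rw [← Complex.mul_conj', ← Complex.mul_conj', map_add]
    ring
  rw [hveq] at hv
  rw [norm_mul] at hv
  set x := ‖z‖ with hxdef
  set y := ‖w‖ with hydef
  have hy0 : 0 ≤ y := norm_nonneg _
  have hxy : x * y ≤ 1 := by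
    have := (norm_nonneg _).trans hv
    have h0 : 0 ≤ x * y := by positivity
    nlinarith
  have hy1 : y < 1 := by nlinarith
  -- The left side of `hv` is at least `x(1 - y²) - y(x² - 1) = (x + y)(1 - xy)`. If `xy < 1`, this
  -- gives `(x - 1)(1 - y) ≤ 0`, which is false. If `xy = 1`, it forces `z = x² w`, so `|z + w| = x
  -- + 1/x > 2`.
  rcases hxy.lt_or_eq with hlt | heq
  · have h1 : ‖z * ((1 - y ^ 2 : ℝ) : ℂ)‖ = x * (1 - y ^ 2) := by
      rw [norm_mul, Complex.norm_real, Real.norm_of_nonneg (by nlinarith)]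
    have h2 : ‖w * ((x ^ 2 - 1 : ℝ) : ℂ)‖ = y * (x ^ 2 - 1) := by
      rw [norm_mul, Complex.norm_real, Real.norm_of_nonneg (by nlinarith)]
    have h3 := (norm_sub_norm_le _ _).trans hv
    rw [h1, h2] at h3
    have h4 : (1 - x * y) * (x + y) ≤ (1 - x * y) * (1 + x * y) := by linarith
    have h5 := le_of_mul_le_mul_left h4 (by linarith)
    nlinarith
  · rw [heq] at hv
    have hv0 : z * ((1 - y ^ 2 : ℝ) : ℂ) - w * ((x ^ 2 - 1 : ℝ) : ℂ) = 0 := by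
      rw [← norm_le_zero_iff]
      linarith
    have hyc : (y : ℂ) ^ 2 * (x : ℂ) ^ 2 = 1 := by
      have : (x : ℂ) * y = 1 := by exact_mod_cast heq
      linear_combination ((x : ℂ) * y + 1) * this
    have hfac : (z - x ^ 2 * w) * ((x ^ 2 - 1 : ℝ) : ℂ) = 0 := by
      push_cast at hv0 ⊢
      linear_combination (x : ℂ) ^ 2 * hv0 + z * hyc
    have hne : ((x ^ 2 - 1 : ℝ) : ℂ) ≠ 0 := by
      rw [Complex.ofReal_ne_zero]
      nlinarith
    have hz : z = x ^ 2 * w := by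
      have := (mul_eq_zero.1 hfac).resolve_right hne
      linear_combination this
    have hzw : z + w = ((x ^ 2 + 1 : ℝ) : ℂ) * w := by
      push_cast
      linear_combination hz
    rw [hzw, norm_mul, Complex.norm_real, Real.norm_of_nonneg (by positivity)] at hs
    change (x ^ 2 + 1) * y ≤ 2 at hs
    have hsum : x + y ≤ 2 := by
      have : (x ^ 2 + 1) * y = x + y := by linear_combination x * heq
      linarith
    nlinarith [mul_pos (sub_pos.2 hx) (sub_pos.2 hx)]

/-- The terms `|s|²` cancel, so `ω` enters only through a real part. Optimizing over `ω` turns the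
bounds on `Φ_ω` into `|s - p conj s| ≤ 1 - |p|²`. -/
theorem norm_sq_sub_norm_sq {s p ω : ℂ} (hω : ‖ω‖ = 1) :
    ‖2 - ω * s‖ ^ 2 - ‖2 * ω * p - s‖ ^ 2 =
      4 * (1 - ‖p‖ ^ 2 - (ω * (s - p * conj s)).re) := by
  have h : ω.re * ω.re + ω.im * ω.im = 1 := by
    rw [← Complex.normSq_apply, ← Complex.sq_norm, hω, one_pow]
  simp only [Complex.sq_norm, Complex.normSq_apply, Complex.sub_re, Complex.sub_im,
    Complex.mul_re, Complex.mul_im, Complex.conj_re, Complex.conj_im, Complex.re_ofNat,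
    Complex.im_ofNat]
  linear_combination (s.re * s.re + s.im * s.im - 4 * (p.re * p.re + p.im * p.im)) * h

/-- The criterion for membership of `Γ` in terms of the functions `Φ_ω`. -/
theorem mem_Gam_of_norm_le {s p : ℂ} (hs : ‖s‖ ≤ 2)
    (h : ∀ ω : ℂ, ‖ω‖ = 1 → ‖2 * ω * p - s‖ ≤ ‖2 - ω * s‖) : (s, p) ∈ Gam := by
  have hre : ∀ ω : ℂ, ‖ω‖ = 1 → (ω * (s - p * conj s)).re ≤ 1 - ‖p‖ ^ 2 := by
    intro ω hω
    have h1 := norm_sq_sub_norm_sq (s := s) (p := p) hω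
    have h2 := pow_le_pow_left₀ (norm_nonneg _) (h ω hω) 2
    linarith
  have hv : ‖s - p * conj s‖ ≤ 1 - ‖p‖ ^ 2 := by
    have h1 := hre (Complex.exp (((-(s - p * conj s).arg : ℝ) : ℂ) * Complex.I))
      (Complex.norm_exp_ofReal_mul_I _)
    have h2 : Complex.exp (((-(s - p * conj s).arg : ℝ) : ℂ) * Complex.I) * (s - p * conj s) =
        (‖s - p * conj s‖ : ℂ) := by
      conv_lhs =>
        rw [← Complex.norm_mul_exp_arg_mul_I (s - p * conj s)]
      rw [mul_left_comm, Complex.norm_mul_exp_arg_mul_I, ← Complex.exp_add]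
      simp
    rw [h2, Complex.ofReal_re] at h1
    exact h1
  obtain ⟨u, hu⟩ := IsAlgClosed.exists_pow_nat_eq (s ^ 2 - 4 * p) (n := 2) two_pos
  have hsum : s = (s + u) / 2 + (s - u) / 2 := by ring
  have hprod : p = (s + u) / 2 * ((s - u) / 2) := by linear_combination hu / 4
  refine ⟨(s + u) / 2, (s - u) / 2, ?_, ?_, Prod.ext hsum hprod⟩
  · apply norm_le_one_of_symmetrization (w := (s - u) / 2)
    · rwa [← hsum]
    · rwa [← hsum, ← hprod]
  · apply norm_le_one_of_symmetrization (w := (s + u) / 2)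
    · rwa [add_comm, ← hsum]
    · rwa [add_comm, mul_comm ((s - u) / 2), ← hsum, ← hprod]

theorem mem_bGam_of_mem_Gam {s p : ℂ} (h : (s, p) ∈ Gam) (hp : ‖p‖ = 1) : (s, p) ∈ bGam := by
  obtain ⟨z, w, hz, hw, heq⟩ := h
  obtain ⟨rfl, rfl⟩ := Prod.mk.inj heq
  rw [norm_mul] at hp
  have h1 := norm_nonneg z
  have h2 := norm_nonneg w
  exact ⟨z, w, by nlinarith, by nlinarith, rfl⟩

/-- The term linear in `ω` cancels between `ω = 1` and `ω = -1`. -/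
theorem norm_eq_one_of_norm_eq {s p : ℂ}
    (h : ∀ ω : ℂ, ‖ω‖ = 1 → ‖2 * ω * p - s‖ = ‖2 - ω * s‖) : ‖p‖ = 1 := by
  have h1 := norm_sq_sub_norm_sq (s := s) (p := p) (ω := 1) (by simp)
  have h2 := norm_sq_sub_norm_sq (s := s) (p := p) (ω := -1) (by simp)
  rw [h 1 (by simp)] at h1
  rw [h (-1) (by simp)] at h2
  have h3 : (-1 * (s - p * conj s)).re = -(1 * (s - p * conj s)).re := by
    rw [neg_mul, Complex.neg_re]
  have h4 : ‖p‖ ^ 2 = 1 := by linarith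
  exact (pow_eq_one_iff_of_nonneg (norm_nonneg _) two_ne_zero).1 h4

/-! ### Removing finitely many exceptional parameters. -/

/-- A property that is closed in `ζ` and holds for all but finitely many unimodular `ζ` holds for
all of them. -/
theorem forall_circle_of_forall_not_mem_finite {S F : Set ℂ} (hS : IsClosed S) (hF : F.Finite)
    (h : ∀ ζ : ℂ, ‖ζ‖ = 1 → ζ ∉ F → ζ ∈ S) {ζ : ℂ} (hζ : ‖ζ‖ = 1) : ζ ∈ S := by
  by_contra hmem
  let e : ℝ → ℂ := fun t => Complex.exp ((t : ℂ) * Complex.I)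
  have he : Continuous e := by fun_prop
  have hU : {t : ℝ | e t ∈ Sᶜ} ∩ Set.Ioo (ζ.arg - 1) (ζ.arg + 1) ∈ 𝓝 ζ.arg := by
    refine inter_mem ((hS.isOpen_compl.preimage he).mem_nhds ?_) (Ioo_mem_nhds (by linarith)
      (by linarith))
    simpa [e, exists_eq_exp_of_norm_eq_one hζ] using hmem
  refine Set.infinite_of_injOn_mapsTo (f := e) (t := F) ?_ ?_ (infinite_of_mem_nhds _ hU) hF
  · rintro s ⟨-, hs1, hs2⟩ t ⟨-, ht1, ht2⟩ hst
    obtain ⟨m, hm⟩ := Complex.exp_eq_exp_iff_exists_int.1 hst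
    have h1 : s = t + m * (2 * Real.pi) := by
      have := congrArg Complex.im hm
      simpa using this
    have h2 := Real.pi_gt_three
    have h3 : m = 0 := by
      have h4 : (m : ℝ) < 1 := by nlinarith
      have h5 : (-1 : ℝ) < m := by nlinarith
      have h6 : m < 1 := by exact_mod_cast h4
      have h7 : -1 < m := by exact_mod_cast h5
      omega
    rw [h1, h3]
    simp
  · rintro t ⟨ht, -⟩
    by_contra hF'
    exact ht (h (e t) (Complex.norm_exp_ofReal_mul_I t) hF')

/-- If `c ζ + d` is zero-free on the closed disc for all but finitely many unimodular `ζ`, and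
`c / d` vanishes at some point of the circle, then `|c| ≤ |d|` on the closed disc. -/
theorem norm_eval_le_norm_eval_of_ne_zero {c d : ℂ[X]} {F : Set ℂ} (hF : F.Finite)
    (h : ∀ ζ : ℂ, ‖ζ‖ = 1 → ζ ∉ F → ∀ z : ℂ, ‖z‖ ≤ 1 → c.eval z * ζ + d.eval z ≠ 0)
    {τ : ℂ} (hτ : ‖τ‖ = 1) (hc : c.eval τ = 0) {z : ℂ} (hz : ‖z‖ ≤ 1) :
    ‖c.eval z‖ ≤ ‖d.eval z‖ := by
  obtain ⟨ζ, hζ, hζF⟩ := (infinite_circle.sdiff hF).nonempty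
  change ‖ζ‖ = 1 at hζ
  have hq := h ζ hζ hζF
  have hζ0 : ζ ≠ 0 := norm_ne_zero_iff.1 (by rw [hζ]; exact one_ne_zero)
  -- This is the Cayley transform of `cζ/d`, written without dividing by `d`: the claim is `Re g ≥
  -- 0`. A value `iy` of `g` is a zero of `cζ' + d` with `ζ' = -ζ(1 + iy)/(1 - iy)`. If `Re g`
  -- changed sign, openness of `g` would give an interval of such `y`, hence infinitely many bad
  -- `ζ'`.
  let g : ℂ → ℂ := fun z => (d.eval z - c.eval z * ζ) / (c.eval z * ζ + d.eval z)
  have hgre : ∀ z : ℂ, ‖z‖ ≤ 1 → (g z).re * ‖c.eval z * ζ + d.eval z‖ ^ 2 =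
      ‖d.eval z‖ ^ 2 - ‖c.eval z‖ ^ 2 := by
    intro z hz
    have h1 : ‖c.eval z‖ = ‖c.eval z * ζ‖ := by rw [norm_mul, hζ, mul_one]
    have h2 : ‖c.eval z * ζ + d.eval z‖ ^ 2 ≠ 0 := pow_ne_zero _ (norm_ne_zero_iff.2 (hq z hz))
    rw [h1]
    simp only [g, Complex.div_re, ← Complex.sq_norm]
    rw [← add_div, div_mul_cancel₀ _ h2]
    simp only [Complex.sq_norm, Complex.normSq_apply, Complex.sub_re, Complex.sub_im,
      Complex.add_re, Complex.add_im]
    ring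
  have hgcont : ∀ z : ℂ, ‖z‖ ≤ 1 → ContinuousAt g z := fun z hz =>
    ContinuousAt.div (by fun_prop) (by fun_prop) (hq z hz)
  have hball : ∀ z ∈ Metric.ball (0 : ℂ) 1, ‖z‖ ≤ 1 := fun z hz => by
    rw [mem_ball_zero_iff] at hz
    exact hz.le
  have hgan : AnalyticOnNhd ℂ g (Metric.ball 0 1) := by
    refine DifferentiableOn.analyticOnNhd (fun z hz => ?_) Metric.isOpen_ball
    refine DifferentiableAt.differentiableWithinAt ?_
    exact DifferentiableAt.div (by fun_prop) (by fun_prop) (hq z (hball z hz))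
  have hconn : IsPreconnected (Metric.ball (0 : ℂ) 1) := (convex_ball 0 1).isPreconnected
  have hgτ : g τ = 1 := by
    have := hq τ hτ.le
    simp only [g, hc, zero_mul, sub_zero, zero_add] at this ⊢
    exact div_self this
  have hcl : closure (Metric.ball (0 : ℂ) 1) = Metric.closedBall 0 1 :=
    closure_ball _ one_ne_zero
  obtain ⟨z₁, hz₁, hz₁re⟩ : ∃ z₁ ∈ Metric.ball (0 : ℂ) 1, 0 < (g z₁).re := by
    have h1 : ∀ᶠ w in 𝓝 τ, 0 < (g w).re := by
      have : ContinuousAt (fun w => (g w).re) τ :=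
        Complex.continuous_re.continuousAt.comp (hgcont τ hτ.le)
      refine this.eventually (lt_mem_nhds ?_)
      simp [hgτ]
    have h2 : ∃ᶠ w in 𝓝 τ, w ∈ Metric.ball (0 : ℂ) 1 := by
      rw [← mem_closure_iff_frequently, hcl]
      simp [hτ]
    obtain ⟨w, hw1, hw2⟩ := (h2.and_eventually h1).exists
    exact ⟨w, hw1, hw2⟩
  have key : ∀ z ∈ Metric.ball (0 : ℂ) 1, 0 ≤ (g z).re := by
    intro z hz
    by_contra! hneg
    rcases hgan.is_constant_or_isOpen hconn with ⟨w, hw⟩ | hopen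
    · rw [hw z hz] at hneg
      rw [hw z₁ hz₁] at hz₁re
      linarith
    · obtain ⟨μ, hμ, hμre⟩ : ∃ μ ∈ Metric.ball (0 : ℂ) 1, (g μ).re = 0 := by
        have hcont : ContinuousOn (fun w => (g w).re) (Metric.ball 0 1) := fun w hw =>
          (Complex.continuous_re.continuousAt.comp (hgcont w (hball w hw))).continuousWithinAt
        exact hconn.intermediate_value hz hz₁ hcont ⟨hneg.le, hz₁re.le⟩
      have hO : IsOpen (g '' Metric.ball 0 1) := hopen _ subset_rfl Metric.isOpen_ball
      have hT : {y : ℝ | (y : ℂ) * Complex.I ∈ g '' Metric.ball 0 1} ∈ 𝓝 (g μ).im := by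
        have hcont : Continuous fun y : ℝ => (y : ℂ) * Complex.I := by fun_prop
        refine (hO.preimage hcont).mem_nhds ⟨μ, hμ, ?_⟩
        apply Complex.ext <;> simp [hμre]
      have hne : ∀ y : ℝ, 1 - (y : ℂ) * Complex.I ≠ 0 := by
        intro y h0
        have := congrArg Complex.re h0
        simp at this
      refine Set.infinite_of_injOn_mapsTo
        (f := fun y : ℝ => -(ζ * (1 + y * Complex.I) / (1 - y * Complex.I))) (t := F) ?_ ?_
        (infinite_of_mem_nhds _ hT) hF
      · intro x _ y _ hxy
        have h1 := neg_injective hxy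
        rw [div_eq_div_iff (hne x) (hne y)] at h1
        have h2 : (2 * ζ * Complex.I) * ((x : ℂ) - y) = 0 := by linear_combination h1
        have h3 := (mul_eq_zero.1 h2).resolve_left
          (mul_ne_zero (mul_ne_zero two_ne_zero hζ0) Complex.I_ne_zero)
        exact_mod_cast sub_eq_zero.1 h3
      · rintro y ⟨w, hw, hwy⟩
        by_contra hyF
        refine h _ ?_ hyF w (hball w hw) ?_
        · have h1 : (1 + (y : ℂ) * Complex.I) = conj (1 - (y : ℂ) * Complex.I) := by
            simp
          rw [norm_neg, norm_div, norm_mul, hζ, one_mul, h1, Complex.norm_conj,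
            div_self (norm_ne_zero_iff.2 (hne y))]
        · have h1 : d.eval w - c.eval w * ζ =
              y * Complex.I * (c.eval w * ζ + d.eval w) := by
            rw [← hwy]
            exact (div_mul_cancel₀ _ (hq w (hball w hw))).symm
          field_simp [hne y]
          linear_combination h1
  have hclosed : IsClosed {w : ℂ | ‖c.eval w‖ ≤ ‖d.eval w‖} :=
    isClosed_le c.continuous.norm d.continuous.norm
  have hz' : z ∈ closure (Metric.ball (0 : ℂ) 1) := by
    rw [hcl]
    simpa using hz
  refine closure_minimal (fun w hw => ?_) hclosed hz'
  have h1 := hgre w (hball w hw)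
  have h2 := mul_nonneg (key w hw) (sq_nonneg ‖c.eval w * ζ + d.eval w‖)
  exact le_of_sq_le_sq (by linarith) (norm_nonneg _)

/-! ### Counting the zeros of a self-reflexive polynomial. -/

theorem countP_roots_prod {ι : Type*} (q : ℂ → Prop) [DecidablePred q] (f : ι → ℂ[X])
    (s : Finset ι) (h : ∀ i ∈ s, f i ≠ 0) :
    (∏ i ∈ s, f i).roots.countP q = ∑ i ∈ s, (f i).roots.countP q := by
  classical
  induction s using Finset.induction_on with
  | empty => simp
  | insert i s hi ih =>
    have h1 : ∏ j ∈ s, f j ≠ 0 :=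
      Finset.prod_ne_zero_iff.2 fun j hj => h j (Finset.mem_insert_of_mem hj)
    rw [Finset.prod_insert hi, Finset.sum_insert hi,
      roots_mul (mul_ne_zero (h i (Finset.mem_insert_self i s)) h1), Multiset.countP_add,
      ih fun j hj => h j (Finset.mem_insert_of_mem hj)]

theorem sum_rootMultiplicity_filter (q : ℂ → Prop) [DecidablePred q] (R : ℂ[X]) :
    ∑ z ∈ R.roots.toFinset with q z, (R.rootMultiplicity z : ℚ) = R.roots.countP q := by
  classical
  rw [Multiset.countP_eq_card_filter, ← Multiset.toFinset_sum_count_eq, Multiset.toFinset_filter]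
  push_cast
  refine Finset.sum_congr rfl fun z hz => ?_
  rw [Multiset.count_filter_of_pos (Finset.mem_filter.1 hz).2, count_roots]

/-- The factor of the royal polynomial that belongs to the `j`-th node: a double zero if the node
lies on the circle, and otherwise a pair of zeros that are symmetric with respect to the circle. -/
def BlaschkeData.nodeFactor {n k : ℕ} (B : BlaschkeData n k) (j : Fin n) : ℂ[X] :=
  if (j : ℕ) < k then (X - C (B.σ j)) ^ 2 else (X - C (B.σ j)) * (1 - C (conj (B.σ j)) * X)

section nodeFactor

variable {n k : ℕ} (B : BlaschkeData n k)

theorem one_sub_C_mul_X_ne_zero (σ : ℂ) : (1 - C σ * X : ℂ[X]) ≠ 0 := by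
  intro h
  have := congrArg (eval 0) h
  simp at this

theorem BlaschkeData.nodeFactor_ne_zero (j : Fin n) : B.nodeFactor j ≠ 0 := by
  unfold nodeFactor
  split_ifs
  · exact pow_ne_zero _ (X_sub_C_ne_zero _)
  · exact mul_ne_zero (X_sub_C_ne_zero _) (one_sub_C_mul_X_ne_zero _)

theorem BlaschkeData.norm_σ_le (j : Fin n) : ‖B.σ j‖ ≤ 1 := by
  by_cases h : (j : ℕ) < k
  · exact (B.σ_circle j h).le
  · exact (B.σ_disc j (not_lt.1 h)).le

theorem one_lt_norm_of_mem_roots {σ z : ℂ} (hσ : ‖σ‖ < 1)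
    (hz : z ∈ (1 - C (conj σ) * X : ℂ[X]).roots) : 1 < ‖z‖ := by
  have h1 := (mem_roots'.1 hz).2
  simp only [IsRoot, eval_sub, eval_one, eval_mul, eval_C, eval_X] at h1
  have h2 : ‖σ‖ * ‖z‖ = 1 := by
    rw [← Complex.norm_conj σ, ← norm_mul, ← sub_eq_zero.1 h1, norm_one]
  have h3 := norm_nonneg σ
  by_contra! h4
  nlinarith

theorem BlaschkeData.countP_roots_nodeFactor_disc (j : Fin n) :
    (B.nodeFactor j).roots.countP (‖·‖ < 1) = if (j : ℕ) < k then 0 else 1 := by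
  unfold nodeFactor
  split_ifs with h
  · rw [Multiset.countP_eq_zero]
    intro z hz
    rw [roots_pow, roots_X_sub_C, Multiset.mem_nsmul_of_ne_zero two_ne_zero,
      Multiset.mem_singleton] at hz
    rw [hz, B.σ_circle j h]
    exact lt_irrefl _
  · have hσ := B.σ_disc j (not_lt.1 h)
    rw [roots_mul (mul_ne_zero (X_sub_C_ne_zero _) (one_sub_C_mul_X_ne_zero _)), roots_X_sub_C,
      Multiset.countP_add, Multiset.countP_eq_zero.2
        fun z hz => (one_lt_norm_of_mem_roots hσ hz).not_gt, add_zero,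
      ← Multiset.cons_zero, Multiset.countP_cons_of_pos (p := fun x : ℂ => ‖x‖ < 1) _ hσ, Multiset.countP_zero]

theorem BlaschkeData.countP_roots_nodeFactor_circle (j : Fin n) :
    (B.nodeFactor j).roots.countP (‖·‖ = 1) = if (j : ℕ) < k then 2 else 0 := by
  unfold nodeFactor
  split_ifs with h
  · have hσ := B.σ_circle j h
    rw [roots_pow, roots_X_sub_C, Multiset.countP_nsmul, ← Multiset.cons_zero,
      Multiset.countP_cons_of_pos (p := fun x : ℂ => ‖x‖ = 1) _ hσ, Multiset.countP_zero]
  · have hσ := B.σ_disc j (not_lt.1 h)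
    rw [Multiset.countP_eq_zero]
    intro z hz
    rw [roots_mul (mul_ne_zero (X_sub_C_ne_zero _) (one_sub_C_mul_X_ne_zero _)), roots_X_sub_C,
      Multiset.mem_add, Multiset.mem_singleton] at hz
    rcases hz with rfl | hz
    · exact hσ.ne
    · exact (one_lt_norm_of_mem_roots hσ hz).ne'

/-- The mirror image of the node `0` is at infinity, which costs one degree. -/
theorem BlaschkeData.natDegree_nodeFactor (j : Fin n) :
    (B.nodeFactor j).natDegree + (if B.σ j = 0 then 1 else 0) = 2 := by
  unfold nodeFactor
  by_cases h : (j : ℕ) < k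
  · have : B.σ j ≠ 0 := norm_ne_zero_iff.1 (by rw [B.σ_circle j h]; exact one_ne_zero)
    rw [if_pos h, if_neg this, natDegree_pow, natDegree_X_sub_C]
  · rw [if_neg h, natDegree_mul (X_sub_C_ne_zero _) (one_sub_C_mul_X_ne_zero _),
      natDegree_X_sub_C]
    split_ifs with h0
    · simp [h0]
    · have h1 : (1 - C (conj (B.σ j)) * X : ℂ[X]) = C (-conj (B.σ j)) * X + C 1 := by
        rw [C_neg, C_1]
        ring
      rw [h1, natDegree_linear (neg_ne_zero.2 ((_root_.map_ne_zero _).2 h0))]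

theorem BlaschkeData.root_nodeFactor {j : Fin n} {z : ℂ} (h : (B.nodeFactor j).eval z = 0) :
    z = B.σ j ∨ k ≤ (j : ℕ) ∧ conj (B.σ j) * z = 1 := by
  unfold nodeFactor at h
  split_ifs at h with hj
  · left
    rw [eval_pow, eval_sub, eval_X, eval_C] at h
    exact sub_eq_zero.1 (pow_eq_zero_iff two_ne_zero |>.1 h)
  · rw [eval_mul, mul_eq_zero] at h
    simp only [eval_sub, eval_X, eval_C, eval_one, eval_mul] at h
    exact h.imp sub_eq_zero.1 fun h => ⟨not_lt.1 hj, (sub_eq_zero.1 h).symm⟩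

theorem BlaschkeData.conj_σ_mul_σ_ne_one {i j : Fin n} (hi : k ≤ (i : ℕ)) :
    conj (B.σ i) * B.σ j ≠ 1 := by
  intro h
  have h1 := congrArg norm h
  rw [norm_mul, Complex.norm_conj, norm_one] at h1
  have h2 := B.σ_disc i hi
  have h3 := B.norm_σ_le j
  have h4 := norm_nonneg (B.σ i)
  nlinarith

theorem BlaschkeData.isCoprime_nodeFactor {i j : Fin n} (hij : i ≠ j) :
    IsCoprime (B.nodeFactor i) (B.nodeFactor j) := by
  rw [Polynomial.isCoprime_iff_aeval_ne_zero_of_isAlgClosed ℂ ℂ]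
  intro z
  by_contra! h
  simp only [coe_aeval_eq_eval] at h
  rcases B.root_nodeFactor h.1 with h1 | ⟨hi, h1⟩ <;>
    rcases B.root_nodeFactor h.2 with h2 | ⟨hj, h2⟩
  · exact hij (B.σ_injective (h1.symm.trans h2))
  · exact B.conj_σ_mul_σ_ne_one hj (h1 ▸ h2)
  · exact B.conj_σ_mul_σ_ne_one hi (h2 ▸ h1)
  · have hz : z ≠ 0 := by
      rintro rfl
      simp at h1
    have := mul_right_cancel₀ hz (h1.trans h2.symm)
    exact hij (B.σ_injective ((starRingEnd ℂ).injective this))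

variable {B} {R : ℂ[X]} {κ : ℂ}

/-- On the circle the derivative supplies the second zero; in the disc self-reflexivity supplies the
zero at the mirror image. -/
theorem BlaschkeData.nodeFactor_dvd (hdeg : R.natDegree ≤ 2 * n)
    (hrefl : reflectConj (2 * n) R = C κ * R) (hκ : κ ≠ 0)
    (hroot : ∀ j, R.eval (B.σ j) = 0)
    (hderiv : ∀ j : Fin n, (j : ℕ) < k → R.derivative.eval (B.σ j) = 0) (j : Fin n) :
    B.nodeFactor j ∣ R := by
  unfold nodeFactor
  have hdvd : X - C (B.σ j) ∣ R := dvd_iff_isRoot.2 (hroot j)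
  split_ifs with h
  · obtain ⟨t, rfl⟩ := hdvd
    have h1 := hderiv j h
    simp only [derivative_mul, derivative_sub, derivative_X, derivative_C, sub_zero, one_mul,
      eval_add, eval_mul, eval_sub, eval_X, eval_C, sub_self, zero_mul, add_zero] at h1
    rw [sq]
    exact mul_dvd_mul_left _ (dvd_iff_isRoot.2 h1)
  · have hj := not_lt.1 h
    by_cases h0 : B.σ j = 0
    · simpa [h0] using hdvd
    have h0' : conj (B.σ j) ≠ 0 := (_root_.map_ne_zero _).2 h0
    have h1 : R.eval (conj (B.σ j))⁻¹ = 0 := by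
      have := eval_reflectConj hdeg (inv_ne_zero h0')
      rw [map_inv₀, Complex.conj_conj, inv_inv, hroot j, map_zero, mul_zero, hrefl, eval_mul,
        eval_C] at this
      exact (mul_eq_zero.1 this).resolve_left hκ
    have h2 : (1 - C (conj (B.σ j)) * X : ℂ[X]) =
        C (-conj (B.σ j)) * (X - C (conj (B.σ j))⁻¹) := by
      rw [mul_sub, ← C_mul, neg_mul, mul_inv_cancel₀ h0', C_neg, C_neg, C_1]
      ring
    have h3 : (1 - C (conj (B.σ j)) * X : ℂ[X]) ∣ R := by
      rw [h2, (isUnit_C.2 (neg_ne_zero.2 h0').isUnit).mul_left_dvd]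
      exact dvd_iff_isRoot.2 h1
    refine IsCoprime.mul_dvd ?_ hdvd h3
    rw [Polynomial.isCoprime_iff_aeval_ne_zero_of_isAlgClosed ℂ ℂ]
    intro z
    by_contra! hz
    simp only [coe_aeval_eq_eval, eval_sub, eval_X, eval_C, eval_one, eval_mul] at hz
    refine B.conj_σ_mul_σ_ne_one (i := j) (j := j) hj ?_
    have h4 := (sub_eq_zero.1 hz.2).symm
    rwa [sub_eq_zero.1 hz.1] at h4

/-- A self-reflexive polynomial with the expected zeros at the nodes has no other zeros. -/
theorem BlaschkeData.exists_eq_C_mul_prod_nodeFactor (hR : R ≠ 0) (hdeg : R.natDegree ≤ 2 * n)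
    (hrefl : reflectConj (2 * n) R = C κ * R) (hκ : κ ≠ 0)
    (hroot : ∀ j, R.eval (B.σ j) = 0)
    (hderiv : ∀ j : Fin n, (j : ℕ) < k → R.derivative.eval (B.σ j) = 0) :
    ∃ t : ℂ, t ≠ 0 ∧ R = C t * ∏ j, B.nodeFactor j := by
  have hprod : ∏ j, B.nodeFactor j ≠ 0 :=
    Finset.prod_ne_zero_iff.2 fun j _ => B.nodeFactor_ne_zero j
  obtain ⟨t, ht⟩ : ∏ j, B.nodeFactor j ∣ R :=
    Finset.prod_dvd_of_coprime (fun i _ j _ hij => B.isCoprime_nodeFactor hij)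
      fun j _ => BlaschkeData.nodeFactor_dvd hdeg hrefl hκ hroot hderiv j
  have ht0 : t ≠ 0 := by
    rintro rfl
    exact hR (by rw [ht, mul_zero])
  have hd := natDegree_mul hprod ht0
  rw [← ht, natDegree_prod _ _ fun j _ => B.nodeFactor_ne_zero j] at hd
  have hsum : ∑ j, (B.nodeFactor j).natDegree + ∑ j, (if B.σ j = 0 then 1 else 0) = 2 * n := by
    rw [← Finset.sum_add_distrib, Finset.sum_congr rfl fun j _ => B.natDegree_nodeFactor j]
    simp [mul_comm]
  have htdeg : t.natDegree = 0 := by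
    -- If `0` is a node, the product has degree only `2n - 1`; but `R(0) = 0` then kills the
    -- coefficient of `R` in degree `2n`, by reflection.
    by_cases h0 : ∃ j, B.σ j = 0
    · obtain ⟨j, hj⟩ := h0
      have h1 : ∑ i, (if B.σ i = 0 then 1 else 0) = 1 := by
        rw [Finset.sum_eq_single j, if_pos hj]
        · intro i _ hij
          exact if_neg fun hi => hij (B.σ_injective (hi.trans hj.symm))
        · simp
      have h2 : R.coeff (2 * n) = 0 := by
        have h3 := coeff_reflectConj (2 * n) R
        rw [← hj, hroot j, map_zero, hrefl, coeff_C_mul] at h3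
        exact (mul_eq_zero.1 h3).resolve_left hκ
      have h4 : R.natDegree ≠ 2 * n := by
        intro h5
        rw [← h5] at h2
        exact hR (leadingCoeff_eq_zero.1 h2)
      omega
    · push Not at h0
      have h1 : ∑ i, (if B.σ i = 0 then 1 else 0) = 0 :=
        Finset.sum_eq_zero fun i _ => if_neg (h0 i)
      omega
  obtain ⟨u, rfl⟩ := natDegree_eq_zero.1 htdeg
  refine ⟨u, ?_, by rw [mul_comm]; exact ht⟩
  rintro rfl
  simp at ht0

theorem sum_fin_ite_lt {n k : ℕ} (h : k ≤ n) (x y : ℕ) :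
    ∑ j : Fin n, (if (j : ℕ) < k then x else y) = k * x + (n - k) * y := by
  rw [Fin.sum_univ_eq_sum_range (fun j => if j < k then x else y) n, Finset.range_eq_Ico,
    ← Finset.sum_Ico_consecutive _ (Nat.zero_le k) h]
  congr 1
  · rw [Finset.sum_congr rfl fun j hj => if_pos (Finset.mem_Ico.1 hj).2]
    simp
  · rw [Finset.sum_congr rfl fun j hj => if_neg (Finset.mem_Ico.1 hj).1.not_gt]
    simp

-- A circle node is a double zero counted by halves, and a disc node a simple zero whose mirror
-- image lies outside the disc: each node contributes one.
open scoped Classical in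
theorem BlaschkeData.sum_royalMultiplicity (hR : R ≠ 0) (hdeg : R.natDegree ≤ 2 * n)
    (hrefl : reflectConj (2 * n) R = C κ * R) (hκ : κ ≠ 0)
    (hroot : ∀ j, R.eval (B.σ j) = 0)
    (hderiv : ∀ j : Fin n, (j : ℕ) < k → R.derivative.eval (B.σ j) = 0) :
    ∑ z ∈ R.roots.toFinset with ‖z‖ ≤ 1, royalMultiplicity R z = n ∧
    ∑ z ∈ R.roots.toFinset with ‖z‖ = 1, royalMultiplicity R z = k := by
  obtain ⟨t, ht, hRt⟩ := exists_eq_C_mul_prod_nodeFactor hR hdeg hrefl hκ hroot hderiv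
  have hroots : R.roots = (∏ j, B.nodeFactor j).roots := by rw [hRt, roots_C_mul _ ht]
  have hdisc : R.roots.countP (‖·‖ < 1) = n - k := by
    rw [hroots, countP_roots_prod _ _ _ fun j _ => B.nodeFactor_ne_zero j,
      Finset.sum_congr rfl fun j _ => B.countP_roots_nodeFactor_disc j, sum_fin_ite_lt B.le]
    simp
  have hcircle : R.roots.countP (‖·‖ = 1) = k * 2 := by
    rw [hroots, countP_roots_prod _ _ _ fun j _ => B.nodeFactor_ne_zero j,
      Finset.sum_congr rfl fun j _ => B.countP_roots_nodeFactor_circle j, sum_fin_ite_lt B.le]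
    simp
  have h1 : ∑ z ∈ R.roots.toFinset with ‖z‖ = 1, royalMultiplicity R z = k := by
    have : ∀ z ∈ R.roots.toFinset.filter (‖·‖ = 1),
        royalMultiplicity R z = (R.rootMultiplicity z : ℚ) / 2 := fun z hz => by
      rw [royalMultiplicity, if_neg (Finset.mem_filter.1 hz).2.not_lt]
    rw [Finset.sum_congr rfl this, ← Finset.sum_div, sum_rootMultiplicity_filter, hcircle]
    push_cast
    ring
  have h2 : ∑ z ∈ R.roots.toFinset with ‖z‖ < 1, royalMultiplicity R z = (n : ℚ) - k := by
    have : ∀ z ∈ R.roots.toFinset.filter (‖·‖ < 1),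
        royalMultiplicity R z = (R.rootMultiplicity z : ℚ) := fun z hz => by
      rw [royalMultiplicity, if_pos (Finset.mem_filter.1 hz).2]
    rw [Finset.sum_congr rfl this, sum_rootMultiplicity_filter, hdisc, Nat.cast_sub B.le]
  refine ⟨?_, h1⟩
  have h3 : R.roots.toFinset.filter (‖·‖ ≤ 1) =
      R.roots.toFinset.filter (‖·‖ < 1) ∪ R.roots.toFinset.filter (‖·‖ = 1) := by
    rw [← Finset.filter_or]
    exact Finset.filter_congr fun z _ => le_iff_lt_or_eq
  rw [h3, Finset.sum_union, h1, h2, sub_add_cancel]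
  exact Finset.disjoint_filter.2 fun z _ hz => hz.ne

end nodeFactor

/-! ### What the solutions say about `a, b, c, d`. -/

section solutions

variable {n k : ℕ} {B : BlaschkeData n k}

/-- What the coefficients `a, b, c, d` of a normalized parametrization satisfy. -/
structure BlaschkeData.IsResolvent (B : BlaschkeData n k) (a b c d : ℂ[X]) (τ : ℂ) : Prop where
  natDegree_a : a.natDegree ≤ n
  natDegree_b : b.natDegree ≤ n
  natDegree_c : c.natDegree ≤ n
  natDegree_d : d.natDegree ≤ n
  norm_τ : ‖τ‖ = 1
  eval_a : a.eval τ = 1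
  eval_b : b.eval τ = 0
  eval_c : c.eval τ = 0
  eval_d : d.eval τ = 1
  norm_le : ∀ ζ : ℂ, ‖ζ‖ = 1 → ∀ z : ℂ, ‖z‖ ≤ 1 →
    ‖a.eval z * ζ + b.eval z‖ ≤ ‖c.eval z * ζ + d.eval z‖
  norm_eq : ∀ ζ : ℂ, ‖ζ‖ = 1 → ∀ z : ℂ, ‖z‖ = 1 →
    ‖a.eval z * ζ + b.eval z‖ = ‖c.eval z * ζ + d.eval z‖
  norm_c_le : ∀ z : ℂ, ‖z‖ ≤ 1 → ‖c.eval z‖ ≤ ‖d.eval z‖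
  d_ne_zero : ∀ z : ℂ, ‖z‖ ≤ 1 → d.eval z ≠ 0
  reflect_c : reflectConj n c = C (τ ^ n) * b
  reflect_d : reflectConj n d = C (τ ^ n) * a
  a_node : ∀ j, a.eval (B.σ j) = B.η j * c.eval (B.σ j)
  b_node : ∀ j, b.eval (B.σ j) = B.η j * d.eval (B.σ j)
  deriv_a_node : ∀ j : Fin k,
    B.σ (Fin.castLE B.le j) * (a.derivative.eval (B.σ (Fin.castLE B.le j)) -
      B.η (Fin.castLE B.le j) * c.derivative.eval (B.σ (Fin.castLE B.le j))) =
    B.ρ j * B.η (Fin.castLE B.le j) * c.eval (B.σ (Fin.castLE B.le j))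
  deriv_b_node : ∀ j : Fin k,
    B.σ (Fin.castLE B.le j) * (b.derivative.eval (B.σ (Fin.castLE B.le j)) -
      B.η (Fin.castLE B.le j) * d.derivative.eval (B.σ (Fin.castLE B.le j))) =
    B.ρ j * B.η (Fin.castLE B.le j) * d.eval (B.σ (Fin.castLE B.le j))

variable {N Q : ℂ[X]}

theorem BlaschkeData.IsSolution.eval_ne_zero (h : B.IsSolution (quot N Q)) (hN : N.natDegree ≤ n)
    (hQ : Q.natDegree ≤ n) {z : ℂ} (hz : ‖z‖ ≤ 1) : Q.eval z ≠ 0 := by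
  obtain ⟨u, hu, -, h2⟩ := lowest_terms_of_ratDegree B.one_le hN hQ h.2.1
  rw [h2, eval_mul, eval_C]
  exact mul_ne_zero hu (eval_denom_ne_zero_of_isInner h.1 hz)

theorem BlaschkeData.IsSolution.norm_le (h : B.IsSolution (quot N Q)) (hN : N.natDegree ≤ n)
    (hQ : Q.natDegree ≤ n) {z : ℂ} (hz : ‖z‖ ≤ 1) : ‖N.eval z‖ ≤ ‖Q.eval z‖ := by
  obtain ⟨u, hu, h1, h2⟩ := lowest_terms_of_ratDegree B.one_le hN hQ h.2.1
  have h3 := congrArg (eval z) h1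
  have h4 := congrArg (eval z) h2
  rw [eval_mul, eval_C] at h3 h4
  rw [h3, h4, norm_mul, norm_mul]
  exact mul_le_mul_of_nonneg_left (norm_eval_num_le_norm_eval_denom h.1 hz) (norm_nonneg u)

theorem BlaschkeData.IsSolution.norm_eq (h : B.IsSolution (quot N Q)) (hN : N.natDegree ≤ n)
    (hQ : Q.natDegree ≤ n) {z : ℂ} (hz : ‖z‖ = 1) : ‖N.eval z‖ = ‖Q.eval z‖ := by
  obtain ⟨u, hu, h1, h2⟩ := lowest_terms_of_ratDegree B.one_le hN hQ h.2.1
  have h3 := congrArg (eval z) h1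
  have h4 := congrArg (eval z) h2
  rw [eval_mul, eval_C] at h3 h4
  rw [h3, h4, norm_mul, norm_mul, norm_eval_num_eq_norm_eval_denom h.1 hz]

theorem BlaschkeData.IsSolution.exists_reflectConj_eq (h : B.IsSolution (quot N Q))
    (hN : N.natDegree ≤ n) (hQ : Q.natDegree ≤ n) : ∃ κ : ℂ, reflectConj n Q = C κ * N := by
  refine exists_reflectConj_eq_C_mul hN hQ ?_ ?_ (h.eval_ne_zero hN hQ (by simp))
    fun z hz => h.norm_eq hN hQ hz
  · obtain ⟨u, hu, h1, h2⟩ := lowest_terms_of_ratDegree B.one_le hN hQ h.2.1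
    have h3 : N.natDegree = (quot N Q).num.natDegree := by
      conv_lhs => rw [h1]
      exact natDegree_C_mul hu
    have h4 : Q.natDegree = (quot N Q).denom.natDegree := by
      conv_lhs => rw [h2]
      exact natDegree_C_mul hu
    rw [h3, h4]
    exact h.2.1
  · obtain ⟨u, hu, h1, h2⟩ := lowest_terms_of_ratDegree B.one_le hN hQ h.2.1
    have hc := RatFunc.isCoprime_num_denom (quot N Q)
    have hunit : IsUnit (C u) := isUnit_C.2 hu.isUnit
    have := (isCoprime_mul_unit_left hunit _ _).2 hc
    rwa [← h1, ← h2] at this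

theorem BlaschkeData.IsSolution.eval_node (h : B.IsSolution (quot N Q)) (hN : N.natDegree ≤ n)
    (hQ : Q.natDegree ≤ n) (j : Fin n) : N.eval (B.σ j) = B.η j * Q.eval (B.σ j) := by
  have hne := h.eval_ne_zero hN hQ (B.norm_σ_le j)
  have h1 := h.2.2.1 j
  rwa [val_quot hne, div_eq_iff hne] at h1

theorem BlaschkeData.IsSolution.deriv_node (h : B.IsSolution (quot N Q)) (hN : N.natDegree ≤ n)
    (hQ : Q.natDegree ≤ n) (j : Fin k) :
    B.σ (Fin.castLE B.le j) * (N.derivative.eval (B.σ (Fin.castLE B.le j)) -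
      B.η (Fin.castLE B.le j) * Q.derivative.eval (B.σ (Fin.castLE B.le j))) =
    B.ρ j * B.η (Fin.castLE B.le j) * Q.eval (B.σ (Fin.castLE B.le j)) := by
  have hne := h.eval_ne_zero hN hQ (B.norm_σ_le (Fin.castLE B.le j))
  have h1 : ∀ w : ℂ, ‖w‖ = 1 → ‖val (quot N Q) w‖ = 1 := fun w hw => by
    have hw' := h.eval_ne_zero hN hQ hw.le
    rw [val_quot hw', norm_div, h.norm_eq hN hQ hw, div_self (norm_ne_zero_iff.2 hw')]
  have h2 := (h.2.2.2 j).mul_deriv_eq (hasDerivAt_val_quot N hne) h1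
  rw [h.2.2.1, h.eval_node hN hQ] at h2
  field_simp at h2
  linear_combination h2

theorem eq_zero_of_mul_add_eq_zero {x y ζ₁ ζ₂ : ℂ} (hζ : ζ₁ ≠ ζ₂) (h₁ : x * ζ₁ + y = 0)
    (h₂ : x * ζ₂ + y = 0) : x = 0 ∧ y = 0 := by
  have h : x * (ζ₁ - ζ₂) = 0 := by linear_combination h₁ - h₂
  have hx := (mul_eq_zero.1 h).resolve_right (sub_ne_zero.2 hζ)
  refine ⟨hx, ?_⟩
  rw [hx] at h₁
  simpa using h₁

theorem BlaschkeData.IsNormalizedParametrization.exists_isResolvent {a b c d : ℂ[X]}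
    (h : B.IsNormalizedParametrization a b c d) : ∃ τ, B.IsResolvent a b c d τ := by
  obtain ⟨⟨ha, hb, hc, hd⟩, ⟨F, -, hF⟩, ⟨τ, hτ, -, haτ, hbτ, hcτ, hdτ⟩, -⟩ := h
  have hNdeg : ∀ ζ, (a * C ζ + b).natDegree ≤ n := fun ζ =>
    (natDegree_add_le _ _).trans (max_le ((natDegree_mul_C_le _ _).trans ha) hb)
  have hQdeg : ∀ ζ, (c * C ζ + d).natDegree ≤ n := fun ζ =>
    (natDegree_add_le _ _).trans (max_le ((natDegree_mul_C_le _ _).trans hc) hd)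
  have hsol : ∀ ζ : ℂ, ‖ζ‖ = 1 → ζ ∉ (F : Set ℂ) →
      B.IsSolution (quot (a * C ζ + b) (c * C ζ + d)) := fun ζ hζ hζF =>
    hF ζ hζ (by simpa using hζF)
  obtain ⟨ζ₁, hζ₁, hF₁⟩ := (infinite_circle.sdiff F.finite_toSet).nonempty
  obtain ⟨ζ₂, ⟨hζ₂, hF₂⟩, hne⟩ :=
    ((infinite_circle.sdiff F.finite_toSet).sdiff (Set.finite_singleton ζ₁)).nonempty
  have hζ : ζ₁ ≠ ζ₂ := fun h => hne h.symm
  have s₁ := hsol ζ₁ hζ₁ hF₁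
  have s₂ := hsol ζ₂ hζ₂ hF₂
  have hden : ∀ ζ : ℂ, ‖ζ‖ = 1 → ζ ∉ (F : Set ℂ) → ∀ z : ℂ, ‖z‖ ≤ 1 →
      c.eval z * ζ + d.eval z ≠ 0 := fun ζ hζ hζF z hz => by
    simpa using (hsol ζ hζ hζF).eval_ne_zero (hNdeg ζ) (hQdeg ζ) hz
  have hcd : ∀ z : ℂ, ‖z‖ ≤ 1 → ‖c.eval z‖ ≤ ‖d.eval z‖ := fun z hz =>
    norm_eval_le_norm_eval_of_ne_zero F.finite_toSet hden hτ hcτ hz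
  -- Evaluating `Q~ = κ N` at `τ` gives `κ ζ = τ^n`. Multiplying by `ζ` and using `ζ conj ζ = 1`
  -- leaves an identity affine in `ζ`.
  have hreflect : ∀ ζ : ℂ, ‖ζ‖ = 1 → ζ ∉ (F : Set ℂ) → ∀ z,
      (reflectConj n d - C (τ ^ n) * a).eval z * ζ + (reflectConj n c - C (τ ^ n) * b).eval z
        = 0 := by
    intro ζ hζ hζF z
    obtain ⟨κ, hκ⟩ := (hsol ζ hζ hζF).exists_reflectConj_eq (hNdeg ζ) (hQdeg ζ)
    have hone : ζ * conj ζ = 1 := by rw [Complex.mul_conj', hζ]; simp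
    have h1 := congrArg (eval τ) hκ
    rw [eval_reflectConj_of_norm_eq_one (hQdeg ζ) hτ] at h1
    simp only [eval_add, eval_mul, eval_C, haτ, hbτ, hcτ, hdτ, zero_mul, zero_add, map_one,
      mul_one, one_mul, add_zero] at h1
    have h2 := congrArg (eval z) hκ
    rw [reflectConj_add, mul_comm c, reflectConj_C_mul] at h2
    simp only [eval_add, eval_mul, eval_C] at h2
    simp only [eval_sub, eval_mul, eval_C]
    rw [h1]
    linear_combination ζ * h2 - (reflectConj n c).eval z * hone
  have hrc : reflectConj n c = C (τ ^ n) * b := by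
    refine Polynomial.funext fun z => ?_
    have := (eq_zero_of_mul_add_eq_zero hζ (hreflect ζ₁ hζ₁ hF₁ z) (hreflect ζ₂ hζ₂ hF₂ z)).2
    rwa [eval_sub, sub_eq_zero] at this
  have hrd : reflectConj n d = C (τ ^ n) * a := by
    refine Polynomial.funext fun z => ?_
    have := (eq_zero_of_mul_add_eq_zero hζ (hreflect ζ₁ hζ₁ hF₁ z) (hreflect ζ₂ hζ₂ hF₂ z)).1
    rwa [eval_sub, sub_eq_zero] at this
  have hnode : ∀ j, a.eval (B.σ j) - B.η j * c.eval (B.σ j) = 0 ∧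
      b.eval (B.σ j) - B.η j * d.eval (B.σ j) = 0 := by
    intro j
    have e₁ := s₁.eval_node (hNdeg ζ₁) (hQdeg ζ₁) j
    have e₂ := s₂.eval_node (hNdeg ζ₂) (hQdeg ζ₂) j
    simp only [eval_add, eval_mul, eval_C] at e₁ e₂
    exact eq_zero_of_mul_add_eq_zero hζ (by linear_combination e₁) (by linear_combination e₂)
  have hderiv := fun j : Fin k => by
    have e₁ := s₁.deriv_node (hNdeg ζ₁) (hQdeg ζ₁) j
    have e₂ := s₂.deriv_node (hNdeg ζ₂) (hQdeg ζ₂) j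
    simp only [derivative_add, derivative_mul, derivative_C, mul_zero, add_zero, eval_add,
      eval_mul, eval_C] at e₁ e₂
    exact eq_zero_of_mul_add_eq_zero hζ
      (x := B.σ (Fin.castLE B.le j) * (a.derivative.eval (B.σ (Fin.castLE B.le j)) -
        B.η (Fin.castLE B.le j) * c.derivative.eval (B.σ (Fin.castLE B.le j))) -
        B.ρ j * B.η (Fin.castLE B.le j) * c.eval (B.σ (Fin.castLE B.le j)))
      (y := B.σ (Fin.castLE B.le j) * (b.derivative.eval (B.σ (Fin.castLE B.le j)) -
        B.η (Fin.castLE B.le j) * d.derivative.eval (B.σ (Fin.castLE B.le j))) -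
        B.ρ j * B.η (Fin.castLE B.le j) * d.eval (B.σ (Fin.castLE B.le j)))
      (by linear_combination e₁) (by linear_combination e₂)
  refine ⟨τ, ha, hb, hc, hd, hτ, haτ, hbτ, hcτ, hdτ, ?_, ?_, hcd, ?_, hrc, hrd,
    fun j => sub_eq_zero.1 (hnode j).1, fun j => sub_eq_zero.1 (hnode j).2,
    fun j => sub_eq_zero.1 (hderiv j).1, fun j => sub_eq_zero.1 (hderiv j).2⟩
  · intro ζ hζ z hz
    refine forall_circle_of_forall_not_mem_finite
      (S := {ζ | ‖a.eval z * ζ + b.eval z‖ ≤ ‖c.eval z * ζ + d.eval z‖})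
      (isClosed_le (by fun_prop) (by fun_prop)) F.finite_toSet (fun ξ hξ hξF => ?_) hζ
    simpa using (hsol ξ hξ hξF).norm_le (hNdeg ξ) (hQdeg ξ) hz
  · intro ζ hζ z hz
    refine forall_circle_of_forall_not_mem_finite
      (S := {ζ | ‖a.eval z * ζ + b.eval z‖ = ‖c.eval z * ζ + d.eval z‖})
      (isClosed_eq (by fun_prop) (by fun_prop)) F.finite_toSet (fun ξ hξ hξF => ?_) hζ
    simpa using (hsol ξ hξ hξF).norm_eq (hNdeg ξ) (hQdeg ξ) hz
  · intro z hz h0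
    have h1 := hcd z hz
    rw [h0, norm_zero] at h1
    exact hden ζ₁ hζ₁ hF₁ z hz (by rw [norm_le_zero_iff.1 h1, h0]; simp)

end solutions

/-! ### The function `h` and its royal polynomial. -/

section gammaInner

variable {n k : ℕ} {B : BlaschkeData n k} {a b c d : ℂ[X]} {τ s₀ p₀ : ℂ}

theorem BlaschkeData.IsResolvent.reflect_a (h : B.IsResolvent a b c d τ) :
    reflectConj n a = C (τ ^ n) * d := by
  have h1 := congrArg (reflectConj n) h.reflect_d
  rw [reflectConj_reflectConj, reflectConj_C_mul] at h1
  rw [h1, ← mul_assoc, ← C_mul, Complex.mul_conj', norm_pow, h.norm_τ]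
  simp

theorem BlaschkeData.IsResolvent.reflect_b (h : B.IsResolvent a b c d τ) :
    reflectConj n b = C (τ ^ n) * c := by
  have h1 := congrArg (reflectConj n) h.reflect_c
  rw [reflectConj_reflectConj, reflectConj_C_mul] at h1
  rw [h1, ← mul_assoc, ← C_mul, Complex.mul_conj', norm_pow, h.norm_τ]
  simp

theorem BlaschkeData.IsResolvent.τ_ne_zero (h : B.IsResolvent a b c d τ) : τ ≠ 0 :=
  norm_ne_zero_iff.1 (by rw [h.norm_τ]; exact one_ne_zero)

/-- The common denominator of `s` and `p`. -/
theorem BlaschkeData.IsResolvent.denom_ne_zero (h : B.IsResolvent a b c d τ) (hs₀ : ‖s₀‖ < 2)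
    {z : ℂ} (hz : ‖z‖ ≤ 1) : (C s₀ * c - 2 * d).eval z ≠ 0 := by
  simp only [eval_sub, eval_mul, eval_C, eval_ofNat]
  intro h0
  have h1 := congrArg norm (sub_eq_zero.1 h0)
  rw [norm_mul, norm_mul, Complex.norm_ofNat] at h1
  have h2 := h.norm_c_le z hz
  have h3 := norm_pos_iff.2 (h.d_ne_zero z hz)
  have h4 := norm_nonneg s₀
  nlinarith

theorem natDegree_C_mul_sub_C_mul_le {f g : ℂ[X]} (hf : f.natDegree ≤ n) (hg : g.natDegree ≤ n)
    (x y : ℂ) : (C x * f - C y * g).natDegree ≤ n :=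
  (natDegree_sub_le _ _).trans
    (max_le ((natDegree_C_mul_le _ _).trans hf) ((natDegree_C_mul_le _ _).trans hg))

theorem BlaschkeData.IsResolvent.natDegree_denom (h : B.IsResolvent a b c d τ) (s₀ : ℂ) :
    (C s₀ * c - 2 * d).natDegree ≤ n :=
  natDegree_C_mul_sub_C_mul_le h.natDegree_c h.natDegree_d s₀ 2

theorem BlaschkeData.IsResolvent.natDegree_num_s (h : B.IsResolvent a b c d τ) (s₀ p₀ : ℂ) :
    (2 * C p₀ * c - C s₀ * d).natDegree ≤ n := by
  have := natDegree_C_mul_sub_C_mul_le h.natDegree_c h.natDegree_d (2 * p₀) s₀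
  rwa [C_mul] at this

theorem BlaschkeData.IsResolvent.reflect_denom (h : B.IsResolvent a b c d τ) (hp₀ : ‖p₀‖ = 1)
    (hs₀p₀ : s₀ = conj s₀ * p₀) :
    reflectConj n (C s₀ * c - 2 * d) =
      C (τ ^ n * conj p₀) * (-2 * C p₀ * a + C s₀ * b) := by
  have h2 : (2 : ℂ[X]) = C 2 := rfl
  have h3 : conj p₀ * p₀ = 1 := by rw [Complex.conj_mul', hp₀]; simp
  have h4 : conj p₀ * s₀ = conj s₀ := by
    nth_rewrite 1 [hs₀p₀]
    linear_combination conj s₀ * h3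
  have h5 : C (conj p₀) * C p₀ = (1 : ℂ[X]) := by rw [← C_mul, h3, C_1]
  have h6 : C (conj p₀) * C s₀ = (C (conj s₀) : ℂ[X]) := by rw [← C_mul, h4]
  rw [h2, reflectConj_sub, reflectConj_C_mul, reflectConj_C_mul, h.reflect_c, h.reflect_d,
    Complex.conj_ofNat, ← h2, C_mul]
  linear_combination 2 * C (τ ^ n) * a * h5 - C (τ ^ n) * b * h6

/-- The numerator is a multiple of the reflected denominator. A common zero lies outside the closed
disc, and its mirror image would be a zero of the denominator inside. -/
theorem BlaschkeData.IsResolvent.isCoprime_num_denom (h : B.IsResolvent a b c d τ)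
    (hp₀ : ‖p₀‖ = 1) (hs₀p₀ : s₀ = conj s₀ * p₀) (hs₀ : ‖s₀‖ < 2) :
    IsCoprime (-2 * C p₀ * a + C s₀ * b) (C s₀ * c - 2 * d) := by
  rw [Polynomial.isCoprime_iff_aeval_ne_zero_of_isAlgClosed ℂ ℂ]
  intro z
  by_contra! hz
  simp only [coe_aeval_eq_eval] at hz
  have h1 : 1 < ‖z‖ := by
    by_contra! h1
    exact h.denom_ne_zero hs₀ h1 hz.2
  have hz0 : z ≠ 0 := norm_pos_iff.1 (one_pos.trans h1)
  have h2 := congrArg (eval z) (h.reflect_denom hp₀ hs₀p₀)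
  rw [eval_reflectConj (h.natDegree_denom s₀) hz0, eval_mul, hz.1, mul_zero, mul_eq_zero,
    map_eq_zero] at h2
  refine h.denom_ne_zero hs₀ ?_ (h2.resolve_left (pow_ne_zero _ hz0))
  rw [norm_inv, Complex.norm_conj]
  exact inv_le_one_of_one_le₀ h1.le

theorem BlaschkeData.IsResolvent.ratDegree_p (h : B.IsResolvent a b c d τ)
    (hp₀ : ‖p₀‖ = 1) (hs₀p₀ : s₀ = conj s₀ * p₀) (hs₀ : ‖s₀‖ < 2) :
    ratDegree (quot (-2 * C p₀ * a + C s₀ * b) (C s₀ * c - 2 * d)) = n := by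
  have hτ := h.τ_ne_zero
  have hp0 : p₀ ≠ 0 := norm_ne_zero_iff.1 (by rw [hp₀]; exact one_ne_zero)
  have hD0 := h.denom_ne_zero hs₀ (z := 0) (by simp)
  refine ratDegree_quot_of_isCoprime (h.isCoprime_num_denom hp₀ hs₀p₀ hs₀) ?_
    (h.natDegree_denom s₀) fun h0 => hD0 (by rw [h0, eval_zero])
  have hne : τ ^ n * conj p₀ ≠ 0 := mul_ne_zero (pow_ne_zero _ hτ) ((_root_.map_ne_zero _).2 hp0)
  have h1 := natDegree_C_mul (p := -2 * C p₀ * a + C s₀ * b) hne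
  rw [← h.reflect_denom hp₀ hs₀p₀] at h1
  rw [← h1]
  refine le_antisymm (natDegree_reflectConj_le (h.natDegree_denom s₀)) (le_natDegree_of_ne_zero ?_)
  rw [coeff_reflectConj]
  exact (_root_.map_ne_zero _).2 hD0

theorem unimodular_factor_ne_zero (hs₀ : ‖s₀‖ < 2) {ω : ℂ} (hω : ‖ω‖ = 1) : 2 - ω * s₀ ≠ 0 := by
  intro h
  have := congrArg norm (sub_eq_zero.1 h)
  rw [norm_mul, hω, one_mul, Complex.norm_ofNat] at this
  linarith

/-- The numerator is `ω p₀` times the conjugate of the denominator. -/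
theorem norm_unimodular_parameter (hp₀ : ‖p₀‖ = 1) (hs₀p₀ : s₀ = conj s₀ * p₀) (hs₀ : ‖s₀‖ < 2)
    {ω : ℂ} (hω : ‖ω‖ = 1) : ‖(2 * ω * p₀ - s₀) / (2 - ω * s₀)‖ = 1 := by
  have h1 : ω * conj ω = 1 := by rw [Complex.mul_conj', hω]; simp
  have h2 : 2 * ω * p₀ - s₀ = ω * p₀ * conj (2 - ω * s₀) := by
    rw [map_sub, map_mul, Complex.conj_ofNat]
    linear_combination -hs₀p₀ + conj s₀ * p₀ * h1
  rw [norm_div, h2, norm_mul, norm_mul, hω, hp₀, Complex.norm_conj, one_mul, one_mul,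
    div_self (norm_ne_zero_iff.2 (unimodular_factor_ne_zero hs₀ hω))]

theorem four_mul_sub_sq_ne_zero (hp₀ : ‖p₀‖ = 1) (hs₀ : ‖s₀‖ < 2) : 4 * p₀ - s₀ ^ 2 ≠ 0 := by
  intro h
  have := congrArg norm (sub_eq_zero.1 h)
  rw [norm_mul, norm_pow, hp₀, Complex.norm_ofNat] at this
  have := norm_nonneg s₀
  nlinarith

/-- Stated over a commutative ring to serve both for polynomials and for their values. -/
theorem Phi_num_eq {K : Type*} [CommRing K] {a b c d s₀ p₀ ω v ζ : K}
    (hrel : s₀ * a - 2 * b + 2 * p₀ * c - s₀ * d = 0) (hv : v = 2 - ω * s₀)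
    (hζ : v * ζ = 2 * ω * p₀ - s₀) :
    ω * (-2 * p₀ * a + s₀ * b) - (2 * p₀ * c - s₀ * d) = -v * (a * ζ + b) := by
  subst hv
  linear_combination -hrel + a * hζ

theorem Phi_denom_eq {K : Type*} [CommRing K] {c d s₀ p₀ ω v ζ : K} (hv : v = 2 - ω * s₀)
    (hζ : v * ζ = 2 * ω * p₀ - s₀) :
    s₀ * c - 2 * d - ω * (2 * p₀ * c - s₀ * d) = -v * (c * ζ + d) := by
  subst hv
  linear_combination c * hζ

variable (hrel : C s₀ * a - 2 * b + 2 * C p₀ * c - C s₀ * d = 0)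
include hrel

theorem eval_relation (z : ℂ) :
    s₀ * a.eval z - 2 * b.eval z + 2 * p₀ * c.eval z - s₀ * d.eval z = 0 := by
  simpa using congrArg (eval z) hrel

/-- `Φ_ω ∘ (s, p)` is the member of the linear fractional family with parameter
`Φ_ω (s₀, p₀)`. -/
theorem Phi_eq_linFrac (hs₀ : ‖s₀‖ < 2) (hD : C s₀ * c - 2 * d ≠ 0) {ω : ℂ} (hω : ‖ω‖ = 1) :
    Phi ω (2 * quot (2 * C p₀ * c - C s₀ * d) (C s₀ * c - 2 * d))
      (quot (-2 * C p₀ * a + C s₀ * b) (C s₀ * c - 2 * d)) =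
    linFrac a b c d ((2 * ω * p₀ - s₀) / (2 - ω * s₀)) := by
  have hv := unimodular_factor_ne_zero hs₀ hω
  set v := 2 - ω * s₀ with hvdef
  set ζ := (2 * ω * p₀ - s₀) / v with hζdef
  have hvζ : v * ζ = 2 * ω * p₀ - s₀ := mul_div_cancel₀ _ hv
  have hv' : (C v : ℂ[X]) = 2 - C ω * C s₀ := by rw [hvdef, C_sub, C_mul]; rfl
  have hvζ' : (C v * C ζ : ℂ[X]) = 2 * C ω * C p₀ - C s₀ := by
    rw [← C_mul, hvζ, C_sub, C_mul, C_mul]; rfl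
  have hnum := congrArg (algebraMap ℂ[X] (RatFunc ℂ)) (Phi_num_eq hrel hv' hvζ')
  have hden := congrArg (algebraMap ℂ[X] (RatFunc ℂ)) (Phi_denom_eq (c := c) (d := d) hv' hvζ')
  have hD' : algebraMap ℂ[X] (RatFunc ℂ) (C s₀ * c - 2 * d) ≠ 0 :=
    RatFunc.algebraMap_ne_zero hD
  have hv0 : algebraMap ℂ[X] (RatFunc ℂ) (-C v) ≠ 0 :=
    RatFunc.algebraMap_ne_zero (neg_ne_zero.2 (C_ne_zero.2 hv))
  have hω' : algebraMap ℂ (RatFunc ℂ) ω = algebraMap ℂ[X] (RatFunc ℂ) (C ω) :=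
    IsScalarTower.algebraMap_apply ℂ ℂ[X] (RatFunc ℂ) ω
  rw [map_mul] at hnum hden
  rw [map_sub, map_mul] at hnum hden
  rw [linFrac, ← mul_div_mul_left _ _ hv0, ← hnum, ← hden, Phi, hω', quot, quot]
  set x := algebraMap ℂ[X] (RatFunc ℂ) (C s₀ * c - 2 * d)
  set y := algebraMap ℂ[X] (RatFunc ℂ) (2 * C p₀ * c - C s₀ * d)
  set t := algebraMap ℂ[X] (RatFunc ℂ) (-2 * C p₀ * a + C s₀ * b)
  set o := algebraMap ℂ[X] (RatFunc ℂ) (C ω)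
  have e1 : 2 * o * (t / x) - 2 * (y / x) = 2 / x * (o * t - y) := by ring
  have e2 : 2 - o * (2 * (y / x)) = 2 / x * (x - o * y) := by
    field_simp
  rw [e1, e2, mul_div_mul_left _ _ (div_ne_zero two_ne_zero hD')]

theorem BlaschkeData.IsResolvent.norm_Phi_num_le (h : B.IsResolvent a b c d τ) (hp₀ : ‖p₀‖ = 1)
    (hs₀p₀ : s₀ = conj s₀ * p₀) (hs₀ : ‖s₀‖ < 2) {ω z : ℂ} (hω : ‖ω‖ = 1) :
    (‖z‖ ≤ 1 → ‖ω * (-2 * C p₀ * a + C s₀ * b).eval z - (2 * C p₀ * c - C s₀ * d).eval z‖ ≤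
      ‖(C s₀ * c - 2 * d).eval z - ω * (2 * C p₀ * c - C s₀ * d).eval z‖) ∧
    (‖z‖ = 1 → ‖ω * (-2 * C p₀ * a + C s₀ * b).eval z - (2 * C p₀ * c - C s₀ * d).eval z‖ =
      ‖(C s₀ * c - 2 * d).eval z - ω * (2 * C p₀ * c - C s₀ * d).eval z‖) := by
  have hv := unimodular_factor_ne_zero hs₀ hω
  have hζ := norm_unimodular_parameter hp₀ hs₀p₀ hs₀ hω
  have hvζ : (2 - ω * s₀) * ((2 * ω * p₀ - s₀) / (2 - ω * s₀)) = 2 * ω * p₀ - s₀ :=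
    mul_div_cancel₀ _ hv
  simp only [eval_sub, eval_add, eval_mul, eval_C, eval_ofNat, eval_neg]
  rw [Phi_num_eq (eval_relation hrel z) rfl hvζ, Phi_denom_eq rfl hvζ, norm_mul, norm_mul]
  exact ⟨fun hz => mul_le_mul_of_nonneg_left (h.norm_le _ hζ z hz) (norm_nonneg _),
    fun hz => by rw [h.norm_eq _ hζ z hz]⟩

omit hrel in
theorem val_two_mul_quot {f g : ℂ[X]} {z : ℂ} (h : g.eval z ≠ 0) :
    val (2 * quot f g) z = 2 * (f.eval z / g.eval z) := by
  have : 2 * quot f g = quot (2 * f) g := by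
    rw [quot, quot, map_mul, map_ofNat, mul_div_assoc]
  rw [this, val_quot h, eval_mul, eval_ofNat, mul_div_assoc]

omit hrel in
-- This is `|s| ≤ 2`: the difference of squares is `(4 - |s₀|²)(|d|² - |c|²)`.
theorem BlaschkeData.IsResolvent.norm_num_s_le (h : B.IsResolvent a b c d τ) (hp₀ : ‖p₀‖ = 1)
    (hs₀p₀ : s₀ = conj s₀ * p₀) (hs₀ : ‖s₀‖ < 2) {z : ℂ} (hz : ‖z‖ ≤ 1) :
    ‖(2 * C p₀ * c - C s₀ * d).eval z‖ ≤ ‖(C s₀ * c - 2 * d).eval z‖ := by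
  simp only [eval_sub, eval_mul, eval_C, eval_ofNat]
  have hcd := pow_le_pow_left₀ (norm_nonneg _) (h.norm_c_le z hz) 2
  have hs2 : ‖s₀‖ ^ 2 < 4 := by nlinarith [norm_nonneg s₀]
  have hp2 : p₀ * conj p₀ = 1 := by rw [Complex.mul_conj', hp₀]; simp
  have hsp : conj s₀ = s₀ * conj p₀ := by
    have := congrArg conj hs₀p₀
    rwa [map_mul, Complex.conj_conj] at this
  have key : ((‖s₀ * c.eval z - 2 * d.eval z‖ ^ 2 : ℝ) : ℂ) -
      ((‖2 * p₀ * c.eval z - s₀ * d.eval z‖ ^ 2 : ℝ) : ℂ) =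
      (((4 - ‖s₀‖ ^ 2) * (‖d.eval z‖ ^ 2 - ‖c.eval z‖ ^ 2) : ℝ) : ℂ) := by
    push_cast
    simp only [← Complex.mul_conj', map_sub, map_mul, Complex.conj_ofNat]
    rw [hsp]
    linear_combination (-4 * c.eval z * conj (c.eval z) +
      2 * c.eval z * conj (d.eval z) * s₀) * hp2
  have key' : ‖s₀ * c.eval z - 2 * d.eval z‖ ^ 2 - ‖2 * p₀ * c.eval z - s₀ * d.eval z‖ ^ 2 =
      (4 - ‖s₀‖ ^ 2) * (‖d.eval z‖ ^ 2 - ‖c.eval z‖ ^ 2) := by exact_mod_cast key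
  have := mul_nonneg (sub_pos.2 hs2).le (sub_nonneg.2 hcd)
  exact le_of_sq_le_sq (by linarith) (norm_nonneg _)

theorem BlaschkeData.IsResolvent.mem_Gam (h : B.IsResolvent a b c d τ) (hp₀ : ‖p₀‖ = 1)
    (hs₀p₀ : s₀ = conj s₀ * p₀) (hs₀ : ‖s₀‖ < 2) {z : ℂ} (hz : ‖z‖ ≤ 1) :
    (2 * ((2 * C p₀ * c - C s₀ * d).eval z / (C s₀ * c - 2 * d).eval z),
      (-2 * C p₀ * a + C s₀ * b).eval z / (C s₀ * c - 2 * d).eval z) ∈ Gam := by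
  have hD := h.denom_ne_zero hs₀ hz
  have hD' := norm_pos_iff.2 hD
  refine mem_Gam_of_norm_le ?_ fun ω hω => ?_
  · rw [norm_mul, Complex.norm_ofNat, norm_div]
    have := (div_le_one hD').2 (h.norm_num_s_le hp₀ hs₀p₀ hs₀ hz)
    linarith
  · have key := (h.norm_Phi_num_le hrel hp₀ hs₀p₀ hs₀ hω).1 hz
    set x := (C s₀ * c - 2 * d).eval z
    set y := (2 * C p₀ * c - C s₀ * d).eval z
    set t := (-2 * C p₀ * a + C s₀ * b).eval z
    have e1 : 2 * ω * (t / x) - 2 * (y / x) = 2 / x * (ω * t - y) := by ring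
    have e2 : 2 - ω * (2 * (y / x)) = 2 / x * (x - ω * y) := by field_simp
    rw [e1, e2, norm_mul, norm_mul]
    exact mul_le_mul_of_nonneg_left key (norm_nonneg _)

theorem BlaschkeData.IsResolvent.norm_p (h : B.IsResolvent a b c d τ) (hp₀ : ‖p₀‖ = 1)
    (hs₀p₀ : s₀ = conj s₀ * p₀) (hs₀ : ‖s₀‖ < 2) {z : ℂ} (hz : ‖z‖ = 1) :
    ‖(-2 * C p₀ * a + C s₀ * b).eval z / (C s₀ * c - 2 * d).eval z‖ = 1 := by
  have hD := h.denom_ne_zero hs₀ hz.le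
  refine norm_eq_one_of_norm_eq
    (s := 2 * ((2 * C p₀ * c - C s₀ * d).eval z / (C s₀ * c - 2 * d).eval z)) fun ω hω => ?_
  have key := (h.norm_Phi_num_le hrel hp₀ hs₀p₀ hs₀ hω).2 hz
  set x := (C s₀ * c - 2 * d).eval z
  set y := (2 * C p₀ * c - C s₀ * d).eval z
  set t := (-2 * C p₀ * a + C s₀ * b).eval z
  have e1 : 2 * ω * (t / x) - 2 * (y / x) = 2 / x * (ω * t - y) := by ring
  have e2 : 2 - ω * (2 * (y / x)) = 2 / x * (x - ω * y) := by field_simp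
  rw [e1, e2, norm_mul, norm_mul, key]

theorem BlaschkeData.IsResolvent.isRationalGammaInner (h : B.IsResolvent a b c d τ)
    (hp₀ : ‖p₀‖ = 1) (hs₀p₀ : s₀ = conj s₀ * p₀) (hs₀ : ‖s₀‖ < 2) :
    IsRationalGammaInner (2 * quot (2 * C p₀ * c - C s₀ * d) (C s₀ * c - 2 * d))
      (quot (-2 * C p₀ * a + C s₀ * b) (C s₀ * c - 2 * d)) := by
  have hdiff : ∀ z : ℂ, ‖z‖ ≤ 1 → DifferentiableAt ℂ (fun z =>
      (val (2 * quot (2 * C p₀ * c - C s₀ * d) (C s₀ * c - 2 * d)) z,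
        val (quot (-2 * C p₀ * a + C s₀ * b) (C s₀ * c - 2 * d)) z)) z := by
    intro z hz
    have hD := h.denom_ne_zero hs₀ hz
    have h1 := ((hasDerivAt_val_quot (2 * C p₀ * c - C s₀ * d) hD).differentiableAt).const_mul
      (2 : ℂ)
    refine DifferentiableAt.prodMk (h1.congr_of_eventuallyEq ?_)
      (hasDerivAt_val_quot _ hD).differentiableAt
    filter_upwards [(C s₀ * c - 2 * d).continuous.continuousAt.eventually_ne hD] with w hw
    rw [val_two_mul_quot hw, val_quot hw]
  refine ⟨fun z hz => (hdiff z ?_).differentiableWithinAt, fun z hz => ?_,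
    Eventually.of_forall fun θ => ⟨_, ?_, hasRadialLimit_of_continuousAt
      (hdiff _ (Complex.norm_exp_ofReal_mul_I θ).le).continuousAt⟩⟩
  · rw [mem_ball_zero_iff] at hz
    exact hz.le
  · rw [mem_ball_zero_iff] at hz
    have hD := h.denom_ne_zero hs₀ hz.le
    beta_reduce
    rw [val_two_mul_quot hD, val_quot hD]
    exact h.mem_Gam hrel hp₀ hs₀p₀ hs₀ hz.le
  · have hz := Complex.norm_exp_ofReal_mul_I θ
    have hD := h.denom_ne_zero hs₀ hz.le
    rw [val_two_mul_quot hD, val_quot hD]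
    exact mem_bGam_of_mem_Gam (h.mem_Gam hrel hp₀ hs₀p₀ hs₀ hz.le)
      (h.norm_p hrel hp₀ hs₀p₀ hs₀ hz)

theorem BlaschkeData.IsResolvent.eval_num_s_node (h : B.IsResolvent a b c d τ) (j : Fin n) :
    (2 * C p₀ * c - C s₀ * d).eval (B.σ j) = -B.η j * (C s₀ * c - 2 * d).eval (B.σ j) := by
  simp only [eval_sub, eval_mul, eval_C, eval_ofNat]
  linear_combination eval_relation hrel (B.σ j) - s₀ * h.a_node j + 2 * h.b_node j

theorem BlaschkeData.IsResolvent.eval_num_p_node (h : B.IsResolvent a b c d τ) (j : Fin n) :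
    (-2 * C p₀ * a + C s₀ * b).eval (B.σ j) =
      B.η j ^ 2 * (C s₀ * c - 2 * d).eval (B.σ j) := by
  have h1 := h.eval_num_s_node hrel j
  simp only [eval_sub, eval_add, eval_neg, eval_mul, eval_C, eval_ofNat] at h1 ⊢
  linear_combination -B.η j * h1 - 2 * p₀ * h.a_node j + s₀ * h.b_node j

/-- This is `z p'/p = 2ρ` without denominators. One `ρ` comes with `s₀c - 2d` and an equal one with
`2p₀c - s₀d`, which is `-η` times it at the node. -/
theorem BlaschkeData.IsResolvent.deriv_num_p_node (h : B.IsResolvent a b c d τ) (j : Fin k) :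
    B.σ (Fin.castLE B.le j) *
        ((-2 * C p₀ * a + C s₀ * b).derivative.eval (B.σ (Fin.castLE B.le j)) -
      B.η (Fin.castLE B.le j) ^ 2 *
        (C s₀ * c - 2 * d).derivative.eval (B.σ (Fin.castLE B.le j))) =
    2 * B.ρ j * B.η (Fin.castLE B.le j) ^ 2 *
      (C s₀ * c - 2 * d).eval (B.σ (Fin.castLE B.le j)) := by
  have h1 := h.eval_num_s_node hrel (Fin.castLE B.le j)
  have h2 := congrArg (fun f => f.derivative.eval (B.σ (Fin.castLE B.le j))) hrel
  have h3 := h.deriv_a_node j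
  have h4 := h.deriv_b_node j
  simp only [derivative_add, derivative_sub, derivative_mul, derivative_neg, derivative_C,
    derivative_ofNat, derivative_zero, zero_mul, zero_add, mul_zero, add_zero, neg_zero,
    eval_sub, eval_add, eval_neg, eval_mul, eval_C, eval_ofNat, eval_zero] at h1 h2 ⊢
  linear_combination
    (-2 * p₀ + B.η (Fin.castLE B.le j) * s₀) * h3 +
    (s₀ - 2 * B.η (Fin.castLE B.le j)) * h4 -
    B.σ (Fin.castLE B.le j) * B.η (Fin.castLE B.le j) * h2 -
    B.ρ j * B.η (Fin.castLE B.le j) * h1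

theorem BlaschkeData.IsResolvent.hasPhasarDerivAt_p (h : B.IsResolvent a b c d τ)
    (hp₀ : ‖p₀‖ = 1) (hs₀p₀ : s₀ = conj s₀ * p₀) (hs₀ : ‖s₀‖ < 2) (j : Fin k) :
    HasPhasarDerivAt (val (quot (-2 * C p₀ * a + C s₀ * b) (C s₀ * c - 2 * d)))
      (B.σ (Fin.castLE B.le j)) (2 * B.ρ j) := by
  have hσ : ‖B.σ (Fin.castLE B.le j)‖ = 1 := B.σ_circle _ j.2
  have hD := h.denom_ne_zero hs₀ hσ.le
  refine hasPhasarDerivAt_of_mul_deriv_eq hσ (hasDerivAt_val_quot _ hD) (fun w hw => ?_) ?_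
  · rw [val_quot (h.denom_ne_zero hs₀ hw.le)]
    exact h.norm_p hrel hp₀ hs₀p₀ hs₀ hw
  · have h1 := h.deriv_num_p_node hrel j
    rw [val_quot hD, h.eval_num_p_node hrel]
    push_cast
    field_simp
    linear_combination h1

/-- By the relation, one factor of the square `(2p₀c - s₀d)²` may be replaced by `2b - s₀a`; what
remains is a product of two determinants. -/
theorem royal_polynomial_eq :
    4 * (C s₀ * c - 2 * d) * (-2 * C p₀ * a + C s₀ * b) - (2 * (2 * C p₀ * c - C s₀ * d)) ^ 2 =
      C (4 * (4 * p₀ - s₀ ^ 2)) * (a * d - b * c) := by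
  have h4 : (C 4 : ℂ[X]) = 4 := rfl
  rw [C_mul, C_sub, C_mul, C_pow, h4]
  linear_combination -4 * (2 * C p₀ * c - C s₀ * d) * hrel

-- Reflection swaps `a` with `d` and `b` with `c` up to `τ^n`, so `ad - bc` is self-reflexive. It is
-- `1` at `τ`, and at a node it vanishes because `(a, b) = η (c, d)`. At a circle node `σ (ad -
-- bc)'` reduces to `ρ η (cd - dc) = 0`.
open scoped Classical in
omit hrel in
theorem BlaschkeData.IsResolvent.sum_royalMultiplicity_det (h : B.IsResolvent a b c d τ) {r : ℂ}
    (hr : r ≠ 0) : C r * (a * d - b * c) ≠ 0 ∧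
    ∑ z ∈ (C r * (a * d - b * c)).roots.toFinset with ‖z‖ ≤ 1,
      royalMultiplicity (C r * (a * d - b * c)) z = n ∧
    ∑ z ∈ (C r * (a * d - b * c)).roots.toFinset with ‖z‖ = 1,
      royalMultiplicity (C r * (a * d - b * c)) z = k := by
  have hne : C r * (a * d - b * c) ≠ 0 := by
    intro h0
    have := congrArg (eval τ) h0
    simp [h.eval_a, h.eval_b, h.eval_d, hr] at this
  have hdeg : (C r * (a * d - b * c)).natDegree ≤ 2 * n := by
    refine (natDegree_C_mul_le _ _).trans ((natDegree_sub_le _ _).trans (max_le ?_ ?_))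
    · exact natDegree_mul_le.trans (by have := h.natDegree_a; have := h.natDegree_d; omega)
    · exact natDegree_mul_le.trans (by have := h.natDegree_b; have := h.natDegree_c; omega)
  have hrefl : reflectConj (2 * n) (C r * (a * d - b * c)) =
      C (conj r / r * (τ ^ n) ^ 2) * (C r * (a * d - b * c)) := by
    rw [reflectConj_C_mul, reflectConj_sub, two_mul, reflectConj_mul h.natDegree_a h.natDegree_d,
      reflectConj_mul h.natDegree_b h.natDegree_c, h.reflect_a, h.reflect_b, h.reflect_c,
      h.reflect_d, ← mul_assoc (C _) (C r), ← C_mul, div_mul_eq_mul_div, div_mul_cancel₀ _ hr]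
    simp only [C_mul, C_pow]
    ring
  have hκ : conj r / r * (τ ^ n) ^ 2 ≠ 0 :=
    mul_ne_zero (div_ne_zero ((_root_.map_ne_zero _).2 hr) hr)
      (pow_ne_zero _ (pow_ne_zero _ h.τ_ne_zero))
  refine ⟨hne, BlaschkeData.sum_royalMultiplicity (B := B) hne hdeg hrefl hκ (fun j => ?_) fun j hj => ?_⟩
  · simp only [eval_mul, eval_C, eval_sub]
    linear_combination r * d.eval (B.σ j) * h.a_node j - r * c.eval (B.σ j) * h.b_node j
  · have h1 := h.deriv_a_node ⟨j, hj⟩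
    have h2 := h.deriv_b_node ⟨j, hj⟩
    have hσ : B.σ j ≠ 0 := norm_ne_zero_iff.1 (by rw [B.σ_circle j hj]; exact one_ne_zero)
    have hj' : Fin.castLE B.le ⟨j, hj⟩ = j := rfl
    rw [hj'] at h1 h2
    apply (mul_eq_zero.1 _).resolve_left hσ
    simp only [derivative_mul, derivative_sub, derivative_C, zero_mul, zero_add, eval_mul, eval_C,
      eval_sub, eval_add]
    linear_combination r * d.eval (B.σ j) * h1 - r * c.eval (B.σ j) * h2 +
      r * B.σ j * d.derivative.eval (B.σ j) * h.a_node j -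
      r * B.σ j * c.derivative.eval (B.σ j) * h.b_node j

theorem BlaschkeData.IsResolvent.hasType (h : B.IsResolvent a b c d τ)
    (hp₀ : ‖p₀‖ = 1) (hs₀p₀ : s₀ = conj s₀ * p₀) (hs₀ : ‖s₀‖ < 2) :
    HasType n k (2 * quot (2 * C p₀ * c - C s₀ * d) (C s₀ * c - 2 * d))
      (quot (-2 * C p₀ * a + C s₀ * b) (C s₀ * c - 2 * d)) := by
  have hp0 : p₀ ≠ 0 := norm_ne_zero_iff.1 (by rw [hp₀]; exact one_ne_zero)
  -- The reflected denominator is `τ^n conj p₀` times the numerator of `p`. Scaling by a square root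
  -- `κ` of this constant makes `p` exactly `D~ / D`, since `conj κ * κ² = κ`.
  obtain ⟨κ, hκ⟩ := IsAlgClosed.exists_pow_nat_eq (τ ^ n * conj p₀) (n := 2) two_pos
  have hκ1 : ‖κ‖ = 1 := by
    have := congrArg norm hκ
    rw [norm_pow, norm_mul, norm_pow, h.norm_τ, Complex.norm_conj, hp₀, one_pow, one_mul] at this
    exact (pow_eq_one_iff_of_nonneg (norm_nonneg _) two_ne_zero).1 this
  have hκ0 : κ ≠ 0 := norm_ne_zero_iff.1 (by rw [hκ1]; exact one_ne_zero)
  have hκC : algebraMap ℂ[X] (RatFunc ℂ) (C κ) ≠ 0 :=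
    RatFunc.algebraMap_ne_zero (C_ne_zero.2 hκ0)
  have hr : κ ^ 2 * (4 * (4 * p₀ - s₀ ^ 2)) ≠ 0 :=
    mul_ne_zero (pow_ne_zero _ hκ0) (mul_ne_zero (by norm_num) (four_mul_sub_sq_ne_zero hp₀ hs₀))
  obtain ⟨hne, hsum⟩ := h.sum_royalMultiplicity_det hr
  have hrefl : reflectConj n (C κ * (C s₀ * c - 2 * d)) =
      C κ * (-2 * C p₀ * a + C s₀ * b) := by
    rw [reflectConj_C_mul, h.reflect_denom hp₀ hs₀p₀, ← hκ, ← mul_assoc, ← C_mul, sq,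
      ← mul_assoc, Complex.conj_mul', hκ1]
    simp
  refine ⟨h.isRationalGammaInner hrel hp₀ hs₀p₀ hs₀, _, ?_, hne, hsum⟩
  rw [IsRoyalPolynomial, h.ratDegree_p hp₀ hs₀p₀ hs₀]
  refine ⟨C κ * (2 * (2 * C p₀ * c - C s₀ * d)), C κ * (C s₀ * c - 2 * d), ?_, ?_, ?_, ?_, ?_, ?_⟩
  · exact (natDegree_C_mul_le _ _).trans
      ((natDegree_C_mul_le 2 _).trans (h.natDegree_num_s s₀ p₀))
  · exact (natDegree_C_mul_le _ _).trans (h.natDegree_denom s₀)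
  · intro z hz
    rw [eval_mul, eval_C]
    exact mul_ne_zero hκ0 (h.denom_ne_zero hs₀ hz)
  · rw [map_mul _ (C κ), map_mul _ (C κ), mul_div_mul_left _ _ hκC, map_mul _ 2, map_ofNat,
      mul_div_assoc]
  · rw [hrefl, map_mul _ (C κ), map_mul _ (C κ), mul_div_mul_left _ _ hκC]
  · rw [hrefl, C_mul, mul_assoc, ← royal_polynomial_eq hrel, C_pow]
    ring

theorem BlaschkeData.IsNormalizedParametrization.finite_not_isSolution_Phi
    (h : B.IsNormalizedParametrization a b c d) (hp₀ : ‖p₀‖ = 1) (hs₀p₀ : s₀ = conj s₀ * p₀)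
    (hs₀ : ‖s₀‖ < 2) (hD : C s₀ * c - 2 * d ≠ 0) :
    {ω : ℂ | ‖ω‖ = 1 ∧
      ¬ B.IsSolution (Phi ω (2 * quot (2 * C p₀ * c - C s₀ * d) (C s₀ * c - 2 * d))
        (quot (-2 * C p₀ * a + C s₀ * b) (C s₀ * c - 2 * d)))}.Finite := by
  obtain ⟨F, -, hF⟩ := h.isSolution
  refine Set.Finite.of_injOn (f := fun ω => (2 * ω * p₀ - s₀) / (2 - ω * s₀))
    (t := (F : Set ℂ)) ?_ ?_ F.finite_toSet
  · rintro ω ⟨hω, hns⟩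
    by_contra hmem
    apply hns
    rw [Phi_eq_linFrac hrel hs₀ hD hω]
    exact hF _ (norm_unimodular_parameter hp₀ hs₀p₀ hs₀ hω) hmem
  · rintro x ⟨hx, -⟩ y ⟨hy, -⟩ hxy
    beta_reduce at hxy
    rw [div_eq_div_iff (unimodular_factor_ne_zero hs₀ hx) (unimodular_factor_ne_zero hs₀ hy)]
      at hxy
    have h1 : (4 * p₀ - s₀ ^ 2) * (x - y) = 0 := by linear_combination hxy
    exact sub_eq_zero.1 ((mul_eq_zero.1 h1).resolve_left (four_mul_sub_sq_ne_zero hp₀ hs₀))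

end gammaInner

end RoyalInterp

end

theorem mainTheorem2 (n k : ℕ) (B : RoyalInterp.BlaschkeData n k)
    (hsolvable : ∃ φ : RatFunc ℂ, B.IsSolution φ)
    (a b c d : ℂ[X]) (hparam : B.IsNormalizedParametrization a b c d)
    (s₀ p₀ : ℂ) (hp₀ : ‖p₀‖ = 1) (hs₀p₀ : s₀ = (starRingEnd ℂ) s₀ * p₀) (hs₀ : ‖s₀‖ < 2)
    (hrel : C s₀ * a - 2 * b + 2 * C p₀ * c - C s₀ * d = 0)
    (s p : RatFunc ℂ)
    (hs : s = 2 * (algebraMap ℂ[X] (RatFunc ℂ) (2 * C p₀ * c - C s₀ * d) /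
      algebraMap ℂ[X] (RatFunc ℂ) (C s₀ * c - 2 * d)))
    (hp : p = algebraMap ℂ[X] (RatFunc ℂ) (-2 * C p₀ * a + C s₀ * b) /
      algebraMap ℂ[X] (RatFunc ℂ) (C s₀ * c - 2 * d)) :
    RoyalInterp.IsRationalGammaInner s p ∧
    RoyalInterp.HasType n k s p ∧
    (∀ j : Fin n, (RoyalInterp.val s (B.σ j), RoyalInterp.val p (B.σ j)) =
      (-2 * B.η j, B.η j ^ 2)) ∧
    (∀ j : Fin k, RoyalInterp.HasPhasarDerivAt (RoyalInterp.val p) (B.σ (Fin.castLE B.le j))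
      (2 * B.ρ j)) ∧
    {ω : ℂ | ‖ω‖ = 1 ∧ ¬ B.IsSolution (RoyalInterp.Phi ω s p)}.Finite := by
  obtain ⟨τ, h⟩ := hparam.exists_isResolvent
  subst hs hp
  have hD : C s₀ * c - 2 * d ≠ 0 := fun h0 =>
    h.denom_ne_zero hs₀ (z := 0) (by simp) (by rw [h0, eval_zero])
  refine ⟨h.isRationalGammaInner hrel hp₀ hs₀p₀ hs₀, h.hasType hrel hp₀ hs₀p₀ hs₀, fun j => ?_,
    h.hasPhasarDerivAt_p hrel hp₀ hs₀p₀ hs₀,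
    hparam.finite_not_isSolution_Phi hrel hp₀ hs₀p₀ hs₀ hD⟩
  have hDj := h.denom_ne_zero hs₀ (B.norm_σ_le j)
  rw [RoyalInterp.val_two_mul_quot hDj, RoyalInterp.val_quot hDj, h.eval_num_s_node hrel,
    h.eval_num_p_node hrel, mul_div_cancel_right₀ _ hDj, mul_div_cancel_right₀ _ hDj]
  congr 1
  ring
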